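/- Let $\Omega\subseteq\mathbb R^2$ be open with $(0,0)\in\Omega$, and let $X:\Omega\to\mathbb R^2$ be a real-analytic vector field with a non-degenerate center at $(0,0)$; that is, $X(0,0)=(0,0)$, $\det DX(0,0)\neq 0$, and there is an open neighbourhood $U\subseteq\Omega$ of $(0,0)$ such that the solution of $\dot z=X(z)$ through each point of $U\setminus\{(0,0)\}$ is a non-constant periodic solution in $\Omega$ whose orbit surrounds $(0,0)$ (the origin lies in a bounded connected component of the complement of the orbit). Then there exist $\delta>0$ and a real-analytic even function $V:(-\delta,\delta)\to\mathbb R$ with $V(0)=V'(0)=0$ and $V''(0)>0$ such that, near the origin, $X$ is analytically conjugate to the potential Hamiltonian field $$Y(x,y)=y\,\frac{\partial}{\partial x}-V'(x)\,\frac{\partial}{\partial y}.$$ That is, there are open neighbourhoods $U_1\subseteq\Omega$ and $U_2\subseteq(-\delta,\delta)\times\mathbb R$ of $(0,0)$ and a bijection $h:U_1\to U_2$, real-analytic with real-analytic inverse, such that $h(0,0)=(0,0)$ and $Dh(q)\,X(q)=Y(h(q))$ for every $q\in U_1$. -/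

import Mathlib

/-- `IsPeriodicOrbit X Ω γ`: the set `γ` is the trajectory, contained in `Ω`, of a non-constant
periodic solution of `z' = X z`. -/
def IsPeriodicOrbit (X : ℝ × ℝ → ℝ × ℝ) (Ω γ : Set (ℝ × ℝ)) : Prop :=
  ∃ (z : ℝ → ℝ × ℝ) (T : ℝ), 0 < T ∧ Function.Periodic z T ∧ (∃ t, z t ≠ z 0) ∧
    (∀ t, z t ∈ Ω ∧ HasDerivAt z (X (z t)) t) ∧ γ = Set.range z

/-- The closed curve `γ` surrounds `p`: the point `p` is not on `γ` and lies in a bounded connected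
component of the complement of `γ`. -/
def Surrounds (γ : Set (ℝ × ℝ)) (p : ℝ × ℝ) : Prop :=
  p ∉ γ ∧ Bornology.IsBounded (connectedComponentIn γᶜ p)

/-- `p ∈ Ω` is a center of the vector field `X` on the open set `Ω`: it is a singular point with an
open neighbourhood `U` in `Ω` such that the orbit of each point of `U` other than `p` is a periodic
orbit surrounding `p`. -/
def IsCenter (X : ℝ × ℝ → ℝ × ℝ) (Ω : Set (ℝ × ℝ)) (p : ℝ × ℝ) : Prop :=
  X p = 0 ∧ ∃ U : Set (ℝ × ℝ), IsOpen U ∧ p ∈ U ∧ U ⊆ Ω ∧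
    ∀ q ∈ U, q ≠ p → ∃ γ : Set (ℝ × ℝ), IsPeriodicOrbit X Ω γ ∧ q ∈ γ ∧ Surrounds γ p

/-- A center at which the Jacobian determinant of `X` does not vanish. -/
def IsNondegenerateCenter (X : ℝ × ℝ → ℝ × ℝ) (Ω : Set (ℝ × ℝ)) (p : ℝ × ℝ) : Prop :=
  IsCenter X Ω p ∧ (fderiv ℝ X p).det ≠ 0

/-- The vector fields `X` on `Ω₁` and `Y` on `Ω₂` are analytically conjugate near `p` and `p'`:
some analytic diffeomorphism `h` from an open neighbourhood of `p` in `Ω₁` onto an open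
neighbourhood of `p'` in `Ω₂`, with `h p = p'`, satisfies `D_q h (X q) = Y (h q)`. -/
def LocallyAnalyticallyConjugate (X : ℝ × ℝ → ℝ × ℝ) (Ω₁ : Set (ℝ × ℝ)) (p : ℝ × ℝ)
    (Y : ℝ × ℝ → ℝ × ℝ) (Ω₂ : Set (ℝ × ℝ)) (p' : ℝ × ℝ) : Prop :=
  ∃ h : OpenPartialHomeomorph (ℝ × ℝ) (ℝ × ℝ),
    p ∈ h.source ∧ h p = p' ∧ h.source ⊆ Ω₁ ∧ h.target ⊆ Ω₂ ∧
    AnalyticOnNhd ℝ h h.source ∧ AnalyticOnNhd ℝ h.symm h.target ∧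
    ∀ q ∈ h.source, fderiv ℝ h q (X q) = Y (h q)

/-- The potential field `y ∂_x - V'(x) ∂_y`. -/
noncomputable def potentialField (V : ℝ → ℝ) : ℝ × ℝ → ℝ × ℝ :=
  fun z => (z.2, -deriv V z.1)

/-!
An analytic nondegenerate center is conjugate to a potential field because both fields are
conjugate to a rotation at a speed `1 / s (‖z‖ ^ 2)` that depends only on the radius, and every
speed of this kind is realized by an even potential.

*The linear part.* What is used of the center is that every nonzero point near the origin lies on a
periodic trajectory avoiding the origin (`NearbyPeriodic`). This excludes `det < 0`, where a
Ważewski argument produces an orbit that stays near the origin and along which `x ^ 2 - y ^ 2`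
increases (`not_nearbyPeriodic_of_saddle`), and it excludes `det > 0` with nonzero trace, where a
quadratic form is a strict Lyapunov function in one direction of time. So the linear part is
`ω * I` on `ℂ`, and after rescaling time `Y z = I * z + o(z)`.

*Analytic rotation form.* A loop `u c = c * v c` on the unit circle solves `u' = (1 + σ) * Y u` when
`v` solves an equation on the Banach space `C(Circle, ℂ)`, in which `Y` enters through a
superposition operator. Such operators are analytic (`AnalyticAt.exists_superposition`), so the
analytic implicit function theorem solves this equation modulo constants for all small mean values
`z ∈ ℂ` and parameters `σ`, equivariantly under rotations (`exists_lyapunovSchmidt`). The remaining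
scalar equation is divisible by `‖z‖`; its imaginary part determines `σ = S (‖z‖ ^ 2)`, and its real
part is a radial defect `β ‖z‖`. Evaluating the loop at `1` gives a map `h`, analytic at the origin
since it comes from a reduction over the whole plane of parameters, with
`Dh (I * z) = (1 + S (‖z‖ ^ 2)) * Y (h z) - β ‖z‖ * z` (`exists_rotation_normal_form`). If `β` were
not identically zero, it would have a sign on some `(0, ε)`, and `‖h⁻¹ ζ‖ ^ 2` would be a strict
Lyapunov function, for `Y` or for `-Y` (`radial_defect_eq_zero`). So `β = 0` near `0`, and `Y` is
conjugate to `I * z / (1 + S (‖z‖ ^ 2))`.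

*The potential.* For `V = g ^ 2 / 2` and `ζ = y + I * g x` the potential field becomes
`I * ζ / k (Im ζ)` with `k (g x) * g' (x) = 1`, and `V` is even when `k` is even
(`exists_potential_conjugacy`). An analytic change of the angle turns this field into rotation at
speed `1 / s (‖ζ‖ ^ 2)` precisely when `s (ρ ^ 2)` is the average of `k` over the circle of radius
`ρ` (`exists_angle_straightening`). On power series the average multiplies the coefficients of an
even function by the averages of `sin ^ (2 * n)`, which decay at most geometrically, so every
analytic `s` arises from an even analytic `k` (`AnalyticAt.exists_even_circleAverage`).
-/

open Filter Topology Set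

/-! ### Periodic trajectories, Lyapunov functions and continuous dependence -/

/-- Every nonzero point near `0` lies on a periodic trajectory of `z' = X z` that avoids `0`. The
property does not mention a domain of `X`, so it can be transported by linear changes of
coordinates and by time reversal. -/
def NearbyPeriodic {E : Type*} [NormedAddCommGroup E] [NormedSpace ℝ E] (X : E → E) : Prop :=
  ∀ᶠ q in 𝓝 (0 : E), q ≠ 0 → ∃ (z : ℝ → E) (T : ℝ), 0 < T ∧ Function.Periodic z T ∧ z 0 = q ∧
    ∀ t, z t ≠ 0 ∧ HasDerivAt z (X (z t)) t

theorem IsCenter.nearbyPeriodic {X : ℝ × ℝ → ℝ × ℝ} {Ω : Set (ℝ × ℝ)}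
    (h : IsCenter X Ω (0, 0)) : NearbyPeriodic X := by
  obtain ⟨-, U, hU, h0, -, hper⟩ := h
  filter_upwards [hU.mem_nhds h0] with q hq hq0
  obtain ⟨γ, ⟨z, T, hT, hz, -, hsol, rfl⟩, ⟨t₀, rfl⟩, hsur⟩ := hper q hq hq0
  refine ⟨fun t => z (t + t₀), T, hT, fun t => ?_, by simp, fun t => ⟨fun h => ?_, ?_⟩⟩
  · simpa [add_right_comm] using hz (t + t₀)
  · exact hsur.1 ⟨_, h⟩
  · exact (hsol (t + t₀)).2.comp_add_const t t₀

theorem NearbyPeriodic.const_smul {E : Type*} [NormedAddCommGroup E] [NormedSpace ℝ E] {X : E → E}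
    (h : NearbyPeriodic X) {a : ℝ} (ha : 0 < a) : NearbyPeriodic (fun z => a • X z) := by
  filter_upwards [h] with q hq hq0
  obtain ⟨z, T, hT, hz, hz0, hsol⟩ := hq hq0
  refine ⟨fun t => z (a * t), T / a, by positivity, fun t => ?_, by simpa using hz0,
    fun t => ⟨(hsol _).1, ?_⟩⟩
  · have : a * (t + T / a) = a * t + T := by field_simp
    simp only [this, hz (a * t)]
  · have := (hsol (a * t)).2.scomp t ((hasDerivAt_id t).const_mul a)
    simpa [Function.comp_def] using this

section

variable {E F : Type*} [NormedAddCommGroup E] [NormedSpace ℝ E]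
  [NormedAddCommGroup F] [NormedSpace ℝ F] {X : E → E}

theorem NearbyPeriodic.neg (h : NearbyPeriodic X) : NearbyPeriodic (fun z => -X z) := by
  filter_upwards [h] with q hq hq0
  obtain ⟨z, T, hT, hz, hz0, hsol⟩ := hq hq0
  refine ⟨fun t => z (-t), T, hT, fun t => ?_, by simpa using hz0, fun t => ⟨(hsol _).1, ?_⟩⟩
  · change z (-(t + T)) = z (-t)
    rw [neg_add']
    simpa using (hz (-t - T)).symm
  · have := (hsol (-t)).2.scomp t (hasDerivAt_neg t)
    simpa [Function.comp_def] using this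

theorem NearbyPeriodic.conj (h : NearbyPeriodic X) (Φ : E ≃L[ℝ] F) :
    NearbyPeriodic (fun w => Φ (X (Φ.symm w))) := by
  have ht : Tendsto Φ.symm (𝓝 0) (𝓝 0) := by
    simpa using Φ.symm.continuous.tendsto 0
  filter_upwards [ht.eventually h] with q hq hq0
  obtain ⟨z, T, hT, hz, hz0, hsol⟩ := hq (by simpa using hq0)
  refine ⟨fun t => Φ (z t), T, hT, fun t => by simp [hz t], by simp [hz0], fun t => ⟨?_, ?_⟩⟩
  · simpa using (hsol t).1
  · simpa [Function.comp_def] using Φ.hasFDerivAt.comp_hasDerivAt t (hsol t).2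

theorem exists_first_hit {f : ℝ → ℝ} (hf : Continuous f) {a b c : ℝ} (hab : a ≤ b)
    (ha : f a < c) (hb : c ≤ f b) : ∃ τ ∈ Ioc a b, f τ = c ∧ ∀ t ∈ Ico a τ, f t < c := by
  have key : ∀ b', a ≤ b' → c ≤ f b' → ∃ t ∈ Icc a b', f t = c := fun b' h1 h2 => by
    obtain ⟨t, ht, h⟩ := intermediate_value_Icc h1 hf.continuousOn ⟨ha.le, h2⟩
    exact ⟨t, ht, h⟩
  let S := {t | t ∈ Ici a ∧ f t = c}
  have hS : IsClosed S := isClosed_Ici.inter (isClosed_eq hf continuous_const)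
  have hbdd : BddBelow S := ⟨a, fun t ht => ht.1⟩
  obtain ⟨t₁, ht₁, ht₁c⟩ := key b hab hb
  have hmem : sInf S ∈ S := hS.csInf_mem ⟨t₁, ht₁.1, ht₁c⟩ hbdd
  refine ⟨sInf S, ⟨lt_of_le_of_ne hmem.1 ?_, (csInf_le hbdd ⟨ht₁.1, ht₁c⟩).trans ht₁.2⟩, hmem.2,
    fun t ht => ?_⟩
  · intro h
    rw [h, hmem.2] at ha
    exact lt_irrefl _ ha
  · by_contra! hc
    obtain ⟨t₂, ht₂, ht₂c⟩ := key t ht.1 hc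
    have := csInf_le hbdd (show t₂ ∈ S from ⟨ht₂.1, ht₂c⟩)
    linarith [ht.2, ht₂.2]

/-- A strict Lyapunov function excludes small periodic trajectories: a trajectory starting in a
small sublevel set stays near `0` and cannot return to its starting point. -/
theorem not_nearbyPeriodic_of_lyapunov [ProperSpace E] [Nontrivial E] {W : E → ℝ}
    (hd : ∀ᶠ z in 𝓝 (0 : E), DifferentiableAt ℝ W z) (hW0 : W 0 = 0)
    (hW : ∀ᶠ z in 𝓝 (0 : E), z ≠ 0 → 0 < W z ∧ fderiv ℝ W z (X z) < 0) :
    ¬ NearbyPeriodic X := by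
  intro hper
  obtain ⟨ε, hε, hball⟩ := Metric.nhds_basis_closedBall.eventually_iff.1 (hd.and hW)
  have hcont : ContinuousOn W (Metric.closedBall 0 ε) := fun z hz =>
    (hball hz).1.continuousAt.continuousWithinAt
  obtain ⟨p, hp, hmin⟩ := (isCompact_sphere (0 : E) ε).exists_isMinOn
    (NormedSpace.sphere_nonempty.2 hε.le) (hcont.mono Metric.sphere_subset_closedBall)
  have hp0 : p ≠ 0 := ne_zero_of_mem_sphere hε.ne' ⟨p, hp⟩
  have hm : 0 < W p := ((hball (Metric.sphere_subset_closedBall hp)).2 hp0).1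
  have hsmall : ∀ᶠ q in 𝓝 (0 : E), W q < W p :=
    hd.self_of_nhds.continuousAt.eventually (gt_mem_nhds (by rwa [hW0]))
  have hall := (hper.and (hsmall.and (Metric.ball_mem_nhds (0 : E) hε)))
  obtain ⟨q, ⟨hq, hqW, hqε⟩, hq0⟩ :=
    ((hall.filter_mono nhdsWithin_le_nhds).and (self_mem_nhdsWithin (s := {(0 : E)}ᶜ))).exists
  obtain ⟨z, T, hT, hz, hz0, hsol⟩ := hq hq0
  have hzc : Continuous z := continuous_iff_continuousAt.2 fun t => (hsol t).2.continuousAt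
  have hanti : ∀ τ, 0 < τ → (∀ t ∈ Ico 0 τ, ‖z t‖ < ε) → W (z τ) < W (z 0) := by
    intro τ hτ hin
    have hle : ∀ t ∈ Icc 0 τ, z t ∈ Metric.closedBall (0 : E) ε := by
      intro t ht
      have hcl : IsClosed {t | ‖z t‖ ≤ ε} := isClosed_le hzc.norm continuous_const
      have : Icc 0 τ ⊆ {t | ‖z t‖ ≤ ε} := by
        rw [← closure_Ico hτ.ne]
        exact hcl.closure_subset_iff.2 fun t ht => (hin t ht).le
      simpa using this ht
    have hder : ∀ t ∈ Icc 0 τ, HasDerivAt (fun t => W (z t)) (fderiv ℝ W (z t) (X (z t))) t :=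
      fun t ht => (hball (hle t ht)).1.hasFDerivAt.comp_hasDerivAt t (hsol t).2
    refine strictAntiOn_of_deriv_neg (convex_Icc 0 τ)
      (fun t ht => (hder t ht).continuousAt.continuousWithinAt) (fun t ht => ?_)
      (left_mem_Icc.2 hτ.le) (right_mem_Icc.2 hτ.le) hτ
    rw [interior_Icc] at ht
    have ht' := Ioo_subset_Icc_self ht
    rw [(hder t ht').deriv]
    exact ((hball (hle t ht')).2 (hsol t).1).2
  have hstay : ∀ t, 0 ≤ t → ‖z t‖ < ε := by
    by_contra! hc
    obtain ⟨t, ht, htε⟩ := hc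
    obtain ⟨τ, hτ, hτε, hlt⟩ := exists_first_hit hzc.norm ht (by simpa [hz0] using hqε) htε
    have h1 := hanti τ hτ.1 hlt
    have h2 := hmin (show z τ ∈ Metric.sphere (0 : E) ε by simpa using hτε)
    rw [hz0] at h1
    exact lt_irrefl _ ((h1.trans hqW).trans_le h2)
  have := hanti T hT fun t ht => hstay t ht.1
  have hT0 := hz 0
  rw [zero_add] at hT0
  rw [hT0] at this
  exact lt_irrefl _ this

/-- Continuous dependence on the initial point, along a trajectory that stays in an open set where
`X` is Lipschitz. The nearby trajectory is not assumed to stay in this set. -/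
theorem exists_dist_lt_of_trajectories {K : NNReal} {S : Set E} (hS : IsOpen S)
    (hX : LipschitzOnWith K X S) {z₀ : ℝ → E} (hz₀ : ∀ t, HasDerivAt z₀ (X (z₀ t)) t) {t₁ : ℝ}
    (hmem : ∀ t ∈ Icc 0 t₁, z₀ t ∈ S) {η : ℝ} (hη : 0 < η) :
    ∃ d > 0, ∀ z : ℝ → E, (∀ t, HasDerivAt z (X (z t)) t) → dist (z 0) (z₀ 0) < d →
      ∀ t ∈ Icc 0 t₁, dist (z t) (z₀ t) < η := by
  have hc₀ : Continuous z₀ := continuous_iff_continuousAt.2 fun t => (hz₀ t).continuousAt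
  obtain ⟨ρ, hρ, hthick⟩ := (isCompact_Icc.image hc₀).exists_thickening_subset_open hS
    (image_subset_iff.2 hmem)
  set η' := min η ρ with hη'
  have hη'0 : 0 < η' := lt_min hη hρ
  refine ⟨η' * Real.exp (-(K * |t₁|)), by positivity, fun z hz hd t ht => ?_⟩
  have hc : Continuous z := continuous_iff_continuousAt.2 fun t => (hz t).continuousAt
  refine lt_of_lt_of_le ?_ (min_le_left η ρ)
  by_contra! hcon
  have hd' : dist (z 0) (z₀ 0) < η' := by
    refine hd.trans_le (mul_le_of_le_one_right hη'0.le (Real.exp_le_one_iff.2 ?_))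
    have : 0 ≤ (K : ℝ) * |t₁| := by positivity
    linarith
  obtain ⟨τ, hτ, hτη, hlt⟩ := exists_first_hit (hc.dist hc₀) ht.1 hd' hcon
  have hτ₁ : τ ≤ t₁ := hτ.2.trans ht.2
  have hgron := dist_le_of_trajectories_ODE_of_mem (v := fun _ => X) (s := fun _ => S)
    (f := z) (g := z₀) (a := 0) (b := τ) (K := K) (δ := dist (z 0) (z₀ 0))
    (fun t _ => hX) hc.continuousOn
    (fun t _ => (hz t).hasDerivWithinAt) (fun t ht' => hthick ?_) hc₀.continuousOn
    (fun t _ => (hz₀ t).hasDerivWithinAt) (fun t ht' => hmem t ⟨ht'.1, ht'.2.le.trans hτ₁⟩) le_rfl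
    τ (right_mem_Icc.2 hτ.1.le)
  · rw [hτη, sub_zero] at hgron
    have h1 : dist (z 0) (z₀ 0) * Real.exp (K * τ) <
        η' * Real.exp (-(K * |t₁|)) * Real.exp (K * τ) :=
      mul_lt_mul_of_pos_right hd (Real.exp_pos _)
    have h2 : Real.exp (-(K * |t₁|)) * Real.exp (K * τ) ≤ 1 := by
      rw [← Real.exp_add]
      refine Real.exp_le_one_iff.2 ?_
      have : (K : ℝ) * τ ≤ K * |t₁| :=
        mul_le_mul_of_nonneg_left (hτ₁.trans (le_abs_self _)) K.2
      linarith
    rw [mul_assoc] at h1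
    have := mul_le_of_le_one_right hη'0.le h2
    linarith
  · exact Metric.mem_thickening_iff.2 ⟨z₀ t, mem_image_of_mem _ ⟨ht'.1, ht'.2.le.trans hτ₁⟩,
      (hlt t ht').trans_le (min_le_right _ _)⟩

end

/-! ### Linear saddles are not centers -/

/-- Near a linear saddle some point has a non-periodic orbit. This is Ważewski's argument: on a
short segment transverse to the stable direction, the points whose orbits leave a small square to
the right and those whose orbits leave it to the left form disjoint nonempty open sets, so the orbit
of some point of the segment stays in the square, where `x ^ 2 - y ^ 2` increases strictly. -/
theorem not_nearbyPeriodic_of_saddle {X : ℝ × ℝ → ℝ × ℝ} {A : ℝ × ℝ →L[ℝ] ℝ × ℝ}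
    (hX : HasStrictFDerivAt X A 0) (hX0 : X 0 = 0) {μ ν : ℝ} (hμ : 0 < μ) (hν : 0 < ν)
    (hA : ∀ z, A z = (μ * z.1, -(ν * z.2))) : ¬ NearbyPeriodic X := by
  intro hper
  obtain ⟨K, S, hS, hLip⟩ := hX.exists_lipschitzOnWith
  -- the constant `1 / 4` leaves room for the nonlinear terms in `hQpos`
  set c := min μ ν / 4 with hc
  have hcμ : 4 * c ≤ μ := by rw [hc]; linarith [min_le_left μ ν]
  have hcν : 4 * c ≤ ν := by rw [hc]; linarith [min_le_right μ ν]
  have hc0 : 0 < c := by rw [hc]; have := lt_min hμ hν; linarith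
  have hsmall : ∀ᶠ z in 𝓝 (0 : ℝ × ℝ), ‖X z - A z‖ ≤ c * ‖z‖ := by
    have := (hasFDerivAt_iff_isLittleO_nhds_zero.1 hX.hasFDerivAt).def hc0
    simpa [hX0] using this
  obtain ⟨ε, hε, hball⟩ := Metric.nhds_basis_ball.eventually_iff.1
    ((hper.and hsmall).and (eventually_mem_set.2 hS))
  have hbS : Metric.ball (0 : ℝ × ℝ) ε ⊆ S := fun z hz => (hball hz).2
  have hest : ∀ z : ℝ × ℝ, ‖z‖ < ε →
      |(X z).1 - μ * z.1| ≤ c * ‖z‖ ∧ |(X z).2 + ν * z.2| ≤ c * ‖z‖ := by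
    intro z hz
    have h := (hball (show z ∈ Metric.ball 0 ε by simpa using hz)).1.2
    rw [hA] at h
    refine ⟨(norm_fst_le (X z - _)).trans h, ?_⟩
    simpa using (norm_snd_le (X z - (μ * z.1, -(ν * z.2)))).trans h
  -- while a trajectory is in the square, `x ^ 2 - y ^ 2` increases
  have hQpos : ∀ z : ℝ × ℝ, ‖z‖ < ε → z ≠ 0 → 0 < 2 * z.1 * (X z).1 - 2 * z.2 * (X z).2 := by
    intro z hz hz0
    obtain ⟨h1, h2⟩ := hest z hz
    have hn : 0 < ‖z‖ := norm_pos_iff.2 hz0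
    have hz1 : |z.1| ≤ ‖z‖ := norm_fst_le z
    have hz2 : |z.2| ≤ ‖z‖ := norm_snd_le z
    have e1 : |z.1 * ((X z).1 - μ * z.1)| ≤ ‖z‖ * (c * ‖z‖) := by
      rw [abs_mul]; gcongr
    have e2 : |z.2 * ((X z).2 + ν * z.2)| ≤ ‖z‖ * (c * ‖z‖) := by
      rw [abs_mul]; gcongr
    have e3 : ‖z‖ ^ 2 ≤ z.1 ^ 2 + z.2 ^ 2 := by
      rcases max_choice |z.1| |z.2| with h | h <;>
      · rw [show ‖z‖ = max |z.1| |z.2| from rfl, h, sq_abs]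
        nlinarith [sq_nonneg z.1, sq_nonneg z.2]
    have e4 : 4 * c * z.1 ^ 2 ≤ μ * z.1 ^ 2 := by gcongr
    have e5 : 4 * c * z.2 ^ 2 ≤ ν * z.2 ^ 2 := by gcongr
    have e6 : 0 < c * ‖z‖ ^ 2 := by positivity
    have e7 : c * ‖z‖ ^ 2 ≤ c * (z.1 ^ 2 + z.2 ^ 2) := by gcongr
    nlinarith [(abs_le.1 e1).1, (abs_le.1 e2).2]
  -- `|y|` does not increase where `|x| ≤ |y|`: the square cannot be left through its horizontal sides
  have hyneg : ∀ z : ℝ × ℝ, ‖z‖ < ε → |z.1| ≤ |z.2| → 2 * z.2 * (X z).2 ≤ 0 := by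
    intro z hz hle
    obtain ⟨-, h2⟩ := hest z hz
    have hn : ‖z‖ = |z.2| := max_eq_right hle
    have e2 : |z.2 * ((X z).2 + ν * z.2)| ≤ |z.2| * (c * |z.2|) := by
      rw [abs_mul, ← hn]; gcongr
    have e3 : |z.2| * (c * |z.2|) = c * z.2 ^ 2 := by rw [← sq_abs z.2]; ring
    have e5 : c * z.2 ^ 2 ≤ ν * z.2 ^ 2 := by gcongr; linarith
    nlinarith [(abs_le.1 e2).2]
  set η := ε / 4 with hη
  have hη0 : 0 < η := by positivity
  have hpt : ∀ x ∈ Ioo (-(3 * η)) (3 * η), ‖((x, η) : ℝ × ℝ)‖ < ε := by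
    intro x hx
    rw [Prod.norm_mk, Real.norm_eq_abs, Real.norm_eq_abs, abs_of_pos hη0]
    exact max_lt (abs_lt.2 ⟨by linarith [hx.1], by linarith [hx.2]⟩) (by linarith)
  have hex : ∀ x : ℝ, ∃ (z : ℝ → ℝ × ℝ) (T : ℝ), x ∈ Ioo (-(3 * η)) (3 * η) →
      0 < T ∧ Function.Periodic z T ∧ z 0 = (x, η) ∧
        ∀ t, z t ≠ 0 ∧ HasDerivAt z (X (z t)) t := by
    intro x
    by_cases hx : x ∈ Ioo (-(3 * η)) (3 * η)
    · obtain ⟨z, T, h⟩ := (hball (show (x, η) ∈ Metric.ball (0 : ℝ × ℝ) ε by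
        simpa only [mem_ball_zero_iff] using hpt x hx)).1.1
        (by simp [hη0.ne'])
      exact ⟨z, T, fun _ => h⟩
    · exact ⟨fun _ => 0, 0, fun h => absurd h hx⟩
  choose z T hz using hex
  have hzc : ∀ x ∈ Ioo (-(3 * η)) (3 * η), Continuous (z x) := fun x hx =>
    continuous_iff_continuousAt.2 fun t => ((hz x hx).2.2.2 t).2.continuousAt
  have hder1 : ∀ x ∈ Ioo (-(3 * η)) (3 * η), ∀ t,
      HasDerivAt (fun t => (z x t).1) (X (z x t)).1 t := fun x hx t =>
    (ContinuousLinearMap.fst ℝ ℝ ℝ).hasFDerivAt.comp_hasDerivAt t ((hz x hx).2.2.2 t).2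
  have hder2 : ∀ x ∈ Ioo (-(3 * η)) (3 * η), ∀ t,
      HasDerivAt (fun t => (z x t).2) (X (z x t)).2 t := fun x hx t =>
    (ContinuousLinearMap.snd ℝ ℝ ℝ).hasFDerivAt.comp_hasDerivAt t ((hz x hx).2.2.2 t).2
  set Q : ℝ × ℝ → ℝ := fun p => p.1 ^ 2 - p.2 ^ 2 with hQ
  have hQc : Continuous Q := by fun_prop
  have hQder : ∀ x ∈ Ioo (-(3 * η)) (3 * η), ∀ t, HasDerivAt (fun t => Q (z x t))
      (2 * (z x t).1 * (X (z x t)).1 - 2 * (z x t).2 * (X (z x t)).2) t := fun x hx t => by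
    have := ((hder1 x hx t).fun_pow 2).fun_sub ((hder2 x hx t).fun_pow 2)
    simpa using this
  have hQmono : ∀ x ∈ Ioo (-(3 * η)) (3 * η), ∀ a b, (∀ t ∈ Icc a b, ‖z x t‖ < ε) →
      StrictMonoOn (fun t => Q (z x t)) (Icc a b) := by
    intro x hx a b hin
    refine strictMonoOn_of_deriv_pos (convex_Icc a b)
      (fun t _ => (hQder x hx t).continuousAt.continuousWithinAt) (fun t ht => ?_)
    rw [interior_Icc] at ht
    rw [(hQder x hx t).deriv]
    exact hQpos _ (hin t (Ioo_subset_Icc_self ht)) ((hz x hx).2.2.2 t).1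
  -- the orbit enters `{p ∈ O | 0 < Q p}` before leaving the square
  let enters : Set (ℝ × ℝ) → Set ℝ := fun O => {x | x ∈ Ioo (-(3 * η)) (3 * η) ∧
    ∃ t, 0 ≤ t ∧ (∀ s ∈ Icc 0 t, ‖z x s‖ < ε) ∧ 0 < Q (z x t) ∧ z x t ∈ O}
  have hopen : ∀ O : Set (ℝ × ℝ), IsOpen O → IsOpen (enters O) := by
    intro O hO
    rw [isOpen_iff_mem_nhds]
    rintro x ⟨hx, t, ht, hin, hQt, htO⟩
    obtain ⟨m, hm, hmmax⟩ := isCompact_Icc.exists_isMaxOn (nonempty_Icc.2 ht)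
      ((hzc x hx).norm.continuousOn)
    have hO' : IsOpen (O ∩ {p | 0 < Q p}) := hO.inter (isOpen_lt continuous_const hQc)
    obtain ⟨r, hr, hrO⟩ := Metric.isOpen_iff.1 hO' (z x t) ⟨htO, hQt⟩
    obtain ⟨d, hd, hclose⟩ := exists_dist_lt_of_trajectories Metric.isOpen_ball (hLip.mono hbS)
      (fun t => ((hz x hx).2.2.2 t).2) (t₁ := t) (fun s hs => by simpa using hin s hs)
      (η := min r (ε - ‖z x m‖)) (lt_min hr (by linarith [hin m hm]))
    filter_upwards [isOpen_Ioo.mem_nhds hx, Metric.ball_mem_nhds x hd] with x' hx' hx'd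
    have hcl := hclose (z x') (fun t => ((hz x' hx').2.2.2 t).2) (by
      rw [(hz x' hx').2.2.1, (hz x hx).2.2.1, Prod.dist_eq, dist_self]
      exact max_lt hx'd hd)
    have hend := hrO (show z x' t ∈ Metric.ball (z x t) r from
      (hcl t (right_mem_Icc.2 ht)).trans_le (min_le_left _ _))
    refine ⟨hx', t, ht, fun s hs => ?_, hend.2, hend.1⟩
    have h1 := (hcl s hs).trans_le (min_le_right _ _)
    have h2 := hmmax hs
    rw [dist_eq_norm] at h1
    have h3 := norm_le_norm_add_norm_sub' (z x' s) (z x s)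
    simp only [mem_ofPred_eq] at h2
    linarith
  have hR := hopen {p | 0 < p.1} (isOpen_lt continuous_const continuous_fst)
  have hL := hopen {p | p.1 < 0} (isOpen_lt continuous_fst continuous_const)
  have hI : Icc (-(2 * η)) (2 * η) ⊆ Ioo (-(3 * η)) (3 * η) := fun x hx =>
    ⟨by linarith [hx.1], by linarith [hx.2]⟩
  have hstart : ∀ x ∈ Ioo (-(3 * η)) (3 * η), ∀ s ∈ Icc (0 : ℝ) 0, ‖z x s‖ < ε := by
    intro x hx s hs
    rw [Icc_self, mem_singleton_iff] at hs
    rw [hs, (hz x hx).2.2.1]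
    exact hpt x hx
  have hRne : (Icc (-(2 * η)) (2 * η) ∩ enters {p | 0 < p.1}).Nonempty := by
    have hx : 2 * η ∈ Icc (-(2 * η)) (2 * η) := ⟨by linarith, le_rfl⟩
    refine ⟨2 * η, hx, hI hx, 0, le_rfl, hstart _ (hI hx), ?_, ?_⟩
    · rw [(hz _ (hI hx)).2.2.1]
      simp only [hQ]
      nlinarith
    · rw [(hz _ (hI hx)).2.2.1]
      simpa using hη0
  have hLne : (Icc (-(2 * η)) (2 * η) ∩ enters {p | p.1 < 0}).Nonempty := by
    have hx : -(2 * η) ∈ Icc (-(2 * η)) (2 * η) := ⟨le_rfl, by linarith⟩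
    refine ⟨-(2 * η), hx, hI hx, 0, le_rfl, hstart _ (hI hx), ?_, ?_⟩
    · rw [(hz _ (hI hx)).2.2.1]
      simp only [hQ]
      nlinarith
    · rw [(hz _ (hI hx)).2.2.1]
      simpa using hη0
  -- the sign of `x` cannot change while `x ^ 2 - y ^ 2` is positive
  have hkeep : ∀ x ∈ Ioo (-(3 * η)) (3 * η), ∀ a b, 0 ≤ a → a ≤ b →
      (∀ s ∈ Icc 0 b, ‖z x s‖ < ε) → 0 < Q (z x a) → ∀ t ∈ Icc a b, (z x t).1 ≠ 0 := by
    intro x hx a b ha hab hin hQa t ht h0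
    have := (hQmono x hx a b fun s hs => hin s ⟨ha.trans hs.1, hs.2⟩).monotoneOn
      (left_mem_Icc.2 hab) ht ht.1
    simp only [hQ, h0] at this hQa
    nlinarith [sq_nonneg (z x t).2]
  have hdisj : ∀ x, x ∈ enters {p | 0 < p.1} → x ∈ enters {p | p.1 < 0} → False := by
    rintro x ⟨hx, t, ht, hin, hQt, hpos⟩ ⟨-, t', ht', hin', hQt', hneg⟩
    have hc1 := continuous_fst.comp (hzc x hx)
    rcases le_total t t' with h | h
    · obtain ⟨s, hs, hs0⟩ := intermediate_value_Icc' h hc1.continuousOn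
        ⟨le_of_lt hneg, le_of_lt hpos⟩
      exact hkeep x hx t t' ht h hin' hQt s hs hs0
    · obtain ⟨s, hs, hs0⟩ := intermediate_value_Icc h hc1.continuousOn
        ⟨le_of_lt hneg, le_of_lt hpos⟩
      exact hkeep x hx t' t ht' h hin hQt' s hs hs0
  have hcover : Icc (-(2 * η)) (2 * η) ⊆ enters {p | 0 < p.1} ∪ enters {p | p.1 < 0} := by
    intro x hxI
    have hx := hI hxI
    by_contra hcon
    rw [mem_union, not_or] at hcon
    have hQle : ∀ t, 0 ≤ t → (∀ s ∈ Icc 0 t, ‖z x s‖ < ε) → Q (z x t) ≤ 0 := by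
      intro t ht hin
      by_contra! hQt
      rcases lt_trichotomy (z x t).1 0 with h | h | h
      · exact hcon.2 ⟨hx, t, ht, hin, hQt, h⟩
      · simp only [hQ, h] at hQt
        nlinarith [sq_nonneg (z x t).2]
      · exact hcon.1 ⟨hx, t, ht, hin, hQt, h⟩
    have hstay : ∀ t, 0 ≤ t → ‖z x t‖ < ε := by
      by_contra! hc
      obtain ⟨t, ht, htε⟩ := hc
      obtain ⟨τ, hτ, hτε, hlt⟩ := exists_first_hit (hzc x hx).norm ht
        (hstart x hx 0 ⟨le_rfl, le_rfl⟩) htε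
      have hle : ∀ t ∈ Ico 0 τ, |(z x t).1| ≤ |(z x t).2| := by
        intro t ht
        have := hQle t ht.1 fun s hs => hlt s ⟨hs.1, hs.2.trans_lt ht.2⟩
        exact sq_le_sq.1 (by simpa [hQ] using this)
      have hleτ : |(z x τ).1| ≤ |(z x τ).2| := by
        have hcl : IsClosed {t | |(z x t).1| ≤ |(z x t).2|} :=
          isClosed_le (continuous_fst.comp (hzc x hx)).abs (continuous_snd.comp (hzc x hx)).abs
        have hsub : Icc 0 τ ⊆ {t | |(z x t).1| ≤ |(z x t).2|} := by
          rw [← closure_Ico hτ.1.ne]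
          exact hcl.closure_subset_iff.2 hle
        exact hsub (right_mem_Icc.2 hτ.1.le)
      have hanti : AntitoneOn (fun t => (z x t).2 ^ 2) (Icc 0 τ) := by
        have hd : ∀ t, HasDerivAt (fun t => (z x t).2 ^ 2) (2 * (z x t).2 * (X (z x t)).2) t :=
          fun t => by simpa using (hder2 x hx t).fun_pow 2
        refine antitoneOn_of_deriv_nonpos (convex_Icc 0 τ)
          (fun t _ => (hd t).continuousAt.continuousWithinAt)
          (fun t _ => (hd t).differentiableAt.differentiableWithinAt) (fun t ht => ?_)
        rw [interior_Icc] at ht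
        rw [(hd t).deriv]
        have ht' := Ioo_subset_Ico_self ht
        exact hyneg _ (hlt t ht') (hle t ht')
      have h1 := hanti (left_mem_Icc.2 hτ.1.le) (right_mem_Icc.2 hτ.1.le) hτ.1.le
      have h2 : ‖z x τ‖ = |(z x τ).2| := max_eq_right hleτ
      simp only [(hz x hx).2.2.1] at h1
      rw [h2] at hτε
      have h3 := sq_abs (z x τ).2
      rw [hτε] at h3
      nlinarith
    have hmono := hQmono x hx 0 (T x) (fun t ht => hstay t ht.1)
      (left_mem_Icc.2 (hz x hx).1.le) (right_mem_Icc.2 (hz x hx).1.le) (hz x hx).1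
    have hT := (hz x hx).2.1 0
    rw [zero_add] at hT
    simp only [hT] at hmono
    exact lt_irrefl _ hmono
  obtain ⟨x, -, h1, h2⟩ := isPreconnected_Icc _ _ hR hL hcover hRne hLne
  exact hdisj x h1 h2

/-! ### The linear part at a nondegenerate center -/

/-- The linear automorphism of the plane with matrix `!![p, q; r, s]`. -/
noncomputable def planeEquiv (p q r s : ℝ) (h : p * s - q * r ≠ 0) : (ℝ × ℝ) ≃L[ℝ] ℝ × ℝ :=
  LinearEquiv.toContinuousLinearEquiv
    { toFun := fun z => (p * z.1 + q * z.2, r * z.1 + s * z.2)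
      invFun := fun z => ((s * z.1 - q * z.2) / (p * s - q * r),
        (p * z.2 - r * z.1) / (p * s - q * r))
      map_add' := fun z w => by ext <;> simp <;> ring
      map_smul' := fun t z => by ext <;> simp <;> ring
      left_inv := fun z => by
        ext
        · exact (div_eq_iff h).2 (by simp only; ring)
        · exact (div_eq_iff h).2 (by simp only; ring)
      right_inv := fun z => by
        ext
        · simp only [mul_div_assoc', ← add_div]
          exact (div_eq_iff h).2 (by ring)
        · simp only [mul_div_assoc', ← add_div]
          exact (div_eq_iff h).2 (by ring) }

@[simp]
theorem planeEquiv_apply (p q r s : ℝ) (h : p * s - q * r ≠ 0) (z : ℝ × ℝ) :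
    planeEquiv p q r s h z = (p * z.1 + q * z.2, r * z.1 + s * z.2) := rfl

theorem det_eq_of_apply {A : ℝ × ℝ →L[ℝ] ℝ × ℝ} {a b c d : ℝ}
    (hA : ∀ z, A z = (a * z.1 + b * z.2, c * z.1 + d * z.2)) : A.det = a * d - b * c := by
  have : A.det = LinearMap.det (A : ℝ × ℝ →ₗ[ℝ] ℝ × ℝ) := rfl
  rw [this, ← LinearMap.det_toMatrix (Module.Basis.finTwoProd ℝ), Matrix.det_fin_two]
  simp [LinearMap.toMatrix_apply, hA]

section

variable {X : ℝ × ℝ → ℝ × ℝ} {A : ℝ × ℝ →L[ℝ] ℝ × ℝ} {a b c d : ℝ}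

theorem not_nearbyPeriodic_of_diagonalizable (hX : HasStrictFDerivAt X A 0) (hX0 : X 0 = 0)
    (Φ : (ℝ × ℝ) ≃L[ℝ] ℝ × ℝ) {μ ν : ℝ} (hμ : 0 < μ) (hν : 0 < ν)
    (hA : ∀ z, Φ (A z) = (μ * (Φ z).1, -(ν * (Φ z).2))) : ¬ NearbyPeriodic X := by
  intro hper
  refine not_nearbyPeriodic_of_saddle
    (A := (Φ : ℝ × ℝ →L[ℝ] ℝ × ℝ) ∘L A ∘L (Φ.symm : ℝ × ℝ →L[ℝ] ℝ × ℝ)) ?_ (by simp [hX0])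
    hμ hν (fun z => by simp [hA]) (hper.conj Φ)
  refine Φ.hasStrictFDerivAt.comp 0 (HasStrictFDerivAt.comp 0 ?_ Φ.symm.hasStrictFDerivAt)
  simpa using hX

theorem not_nearbyPeriodic_of_det_neg (hX : HasStrictFDerivAt X A 0) (hX0 : X 0 = 0)
    (hA : ∀ z, A z = (a * z.1 + b * z.2, c * z.1 + d * z.2)) (hdet : a * d - b * c < 0) :
    ¬ NearbyPeriodic X := by
  by_cases hc : c = 0
  · subst hc
    have had : a * d < 0 := by simpa using hdet
    rcases mul_neg_iff.1 had with ⟨ha, hd⟩ | ⟨ha, hd⟩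
    · exact not_nearbyPeriodic_of_diagonalizable hX hX0
        (planeEquiv (a - d) b 0 1 (by rw [mul_one, mul_zero, sub_zero]; linarith)) ha
        (neg_pos.2 hd) (fun z => by simp [hA]; ring)
    · exact not_nearbyPeriodic_of_diagonalizable hX hX0
        (planeEquiv 0 1 (a - d) b (by rw [zero_mul, one_mul, zero_sub, neg_ne_zero]; linarith)) hd
        (neg_pos.2 ha) (fun z => by simp [hA]; ring)
  · -- rows of `Φ`: left eigenvectors for the roots of the characteristic polynomial
    set r := √((a + d) ^ 2 - 4 * (a * d - b * c)) with hr
    have hr2 : r ^ 2 = (a + d) ^ 2 - 4 * (a * d - b * c) :=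
      Real.sq_sqrt (by nlinarith [sq_nonneg (a + d)])
    have hr0 : 0 ≤ r := Real.sqrt_nonneg _
    have hlt : |a + d| < r := by
      rw [← abs_of_nonneg hr0]
      exact sq_lt_sq.1 (by linarith)
    have h1 := (abs_lt.1 hlt).1
    have h2 := (abs_lt.1 hlt).2
    refine not_nearbyPeriodic_of_diagonalizable hX hX0
      (planeEquiv c ((a + d + r) / 2 - a) c (-((r - (a + d)) / 2) - a) ?_)
      (μ := (a + d + r) / 2) (ν := (r - (a + d)) / 2) (by linarith) (by linarith) (fun z => ?_)
    · rw [show c * (-((r - (a + d)) / 2) - a) - ((a + d + r) / 2 - a) * c = -(c * r) by ring]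
      have : 0 < r := (abs_nonneg _).trans_lt hlt
      simp [hc, this.ne']
    · ext
      · simp only [hA, planeEquiv_apply]
        linear_combination (-z.2 / 4) * hr2
      · simp only [hA, planeEquiv_apply]
        linear_combination (-z.2 / 4) * hr2

/-- For `det A > 0` and negative trace, `det A * ‖z‖ ^ 2 + ‖(A - tr A) z‖ ^ 2` is a strict Lyapunov
function: by the Cayley–Hamilton theorem its derivative along the linear flow is
`2 * tr A * det A * ‖z‖ ^ 2`. -/
theorem not_nearbyPeriodic_of_trace_neg (hX : HasStrictFDerivAt X A 0) (hX0 : X 0 = 0)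
    (hA : ∀ z, A z = (a * z.1 + b * z.2, c * z.1 + d * z.2)) (hdet : 0 < a * d - b * c)
    (htr : a + d < 0) : ¬ NearbyPeriodic X := by
  set D := a * d - b * c with hD
  let W : ℝ × ℝ → ℝ := fun z => D * (z.1 ^ 2 + z.2 ^ 2) + (b * z.2 - d * z.1) ^ 2 +
    (c * z.1 - a * z.2) ^ 2
  have hWd : ∀ z v, DifferentiableAt ℝ W z ∧ fderiv ℝ W z v =
      2 * (D * (z.1 * v.1 + z.2 * v.2) + (b * z.2 - d * z.1) * (b * v.2 - d * v.1) +
        (c * z.1 - a * z.2) * (c * v.1 - a * v.2)) := by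
    intro z v
    have h1 : HasFDerivAt (fun z : ℝ × ℝ => z.1) (ContinuousLinearMap.fst ℝ ℝ ℝ) z :=
      hasFDerivAt_fst
    have h2 : HasFDerivAt (fun z : ℝ × ℝ => z.2) (ContinuousLinearMap.snd ℝ ℝ ℝ) z :=
      hasFDerivAt_snd
    have h := ((((h1.pow 2).fun_add (h2.pow 2)).const_mul D).fun_add
      (((h2.const_mul b).fun_sub (h1.const_mul d)).pow 2)).fun_add
      (((h1.const_mul c).fun_sub (h2.const_mul a)).pow 2)
    refine ⟨h.differentiableAt, ?_⟩
    rw [h.fderiv]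
    simp
    ring
  set M := |D| + (|b| + |d|) ^ 2 + (|c| + |a|) ^ 2 with hM
  -- relative size of the nonlinear terms that the Lyapunov function tolerates
  set e := -((a + d) * D) / (2 * M + 1) with he
  have hM0 : 0 ≤ M := by positivity
  have htD : 0 < -((a + d) * D) := by nlinarith
  have he0 : 0 < e := by positivity
  have heM : 2 * M * e < -((a + d) * D) := by
    rw [he, mul_div_assoc', div_lt_iff₀ (by positivity)]
    nlinarith
  have hsmall : ∀ᶠ z in 𝓝 (0 : ℝ × ℝ), ‖X z - A z‖ ≤ e * ‖z‖ := by
    have := (hasFDerivAt_iff_isLittleO_nhds_zero.1 hX.hasFDerivAt).def he0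
    simpa [hX0] using this
  refine not_nearbyPeriodic_of_lyapunov (W := W) (.of_forall fun z => (hWd z 0).1) (by simp [W]) ?_
  filter_upwards [hsmall] with z hz hz0
  have hn : 0 < ‖z‖ := norm_pos_iff.2 hz0
  have hz1 : |z.1| ≤ ‖z‖ := norm_fst_le z
  have hz2 : |z.2| ≤ ‖z‖ := norm_snd_le z
  have hsq : ‖z‖ ^ 2 ≤ z.1 ^ 2 + z.2 ^ 2 := by
    rcases max_choice |z.1| |z.2| with h | h <;>
    · rw [show ‖z‖ = max |z.1| |z.2| from rfl, h, sq_abs]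
      nlinarith [sq_nonneg z.1, sq_nonneg z.2]
  refine ⟨?_, ?_⟩
  · have : 0 < D * (z.1 ^ 2 + z.2 ^ 2) := mul_pos hdet (lt_of_lt_of_le (by positivity) hsq)
    have h1 := sq_nonneg (b * z.2 - d * z.1)
    have h2 := sq_nonneg (c * z.1 - a * z.2)
    simp only [W]
    linarith
  · rw [(hWd z _).2]
    obtain ⟨r₁, hr₁⟩ : ∃ r, r = (X z - A z).1 := ⟨_, rfl⟩
    obtain ⟨r₂, hr₂⟩ : ∃ r, r = (X z - A z).2 := ⟨_, rfl⟩
    have hr₁' : |r₁| ≤ e * ‖z‖ := hr₁ ▸ (norm_fst_le _).trans hz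
    have hr₂' : |r₂| ≤ e * ‖z‖ := hr₂ ▸ (norm_snd_le _).trans hz
    have hX1 : (X z).1 = a * z.1 + b * z.2 + r₁ := by simp [hr₁, hA]
    have hX2 : (X z).2 = c * z.1 + d * z.2 + r₂ := by simp [hr₂, hA]
    have hby : |b * z.2 - d * z.1| ≤ (|b| + |d|) * ‖z‖ := by
      refine (abs_sub _ _).trans ?_
      rw [abs_mul, abs_mul, add_mul]
      gcongr
    have hcx : |c * z.1 - a * z.2| ≤ (|c| + |a|) * ‖z‖ := by
      refine (abs_sub _ _).trans ?_
      rw [abs_mul, abs_mul, add_mul]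
      gcongr
    have hbr : |b * r₂ - d * r₁| ≤ (|b| + |d|) * (e * ‖z‖) := by
      refine (abs_sub _ _).trans ?_
      rw [abs_mul, abs_mul, add_mul]
      gcongr
    have hcr : |c * r₁ - a * r₂| ≤ (|c| + |a|) * (e * ‖z‖) := by
      refine (abs_sub _ _).trans ?_
      rw [abs_mul, abs_mul, add_mul]
      gcongr
    have e1 : |(b * z.2 - d * z.1) * (b * r₂ - d * r₁)| ≤
        (|b| + |d|) * ‖z‖ * ((|b| + |d|) * (e * ‖z‖)) := by
      rw [abs_mul]; gcongr
    have e2 : |(c * z.1 - a * z.2) * (c * r₁ - a * r₂)| ≤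
        (|c| + |a|) * ‖z‖ * ((|c| + |a|) * (e * ‖z‖)) := by
      rw [abs_mul]; gcongr
    have e3 : |z.1 * r₁| ≤ ‖z‖ * (e * ‖z‖) := by
      rw [abs_mul]; gcongr
    have e4 : |z.2 * r₂| ≤ ‖z‖ * (e * ‖z‖) := by
      rw [abs_mul]; gcongr
    have e5 : D * (z.1 * r₁ + z.2 * r₂) ≤ D * (2 * (‖z‖ * (e * ‖z‖))) := by
      gcongr
      linarith [(abs_le.1 e3).2, (abs_le.1 e4).2]
    have e6 : (a + d) * D * (z.1 ^ 2 + z.2 ^ 2) ≤ (a + d) * D * ‖z‖ ^ 2 :=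
      mul_le_mul_of_nonpos_left hsq (by linarith)
    have e7 : 2 * M * e * ‖z‖ ^ 2 < -((a + d) * D) * ‖z‖ ^ 2 := by gcongr
    have e8 : 0 ≤ ((|b| + |d|) ^ 2 + (|c| + |a|) ^ 2) * e * ‖z‖ ^ 2 := by positivity
    have hDM : M = D + (|b| + |d|) ^ 2 + (|c| + |a|) ^ 2 := by rw [hM, abs_of_pos hdet]
    rw [hX1, hX2]
    rw [hDM] at e7
    have key : D * (z.1 * (a * z.1 + b * z.2 + r₁) + z.2 * (c * z.1 + d * z.2 + r₂)) +
        (b * z.2 - d * z.1) * (b * (c * z.1 + d * z.2 + r₂) - d * (a * z.1 + b * z.2 + r₁)) +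
        (c * z.1 - a * z.2) * (c * (a * z.1 + b * z.2 + r₁) - a * (c * z.1 + d * z.2 + r₂)) =
        (a + d) * D * (z.1 ^ 2 + z.2 ^ 2) + D * (z.1 * r₁ + z.2 * r₂) +
        (b * z.2 - d * z.1) * (b * r₂ - d * r₁) + (c * z.1 - a * z.2) * (c * r₁ - a * r₂) := by
      rw [hD]; ring
    rw [key]
    linarith [(abs_le.1 e1).2, (abs_le.1 e2).2]

/-- At a nondegenerate center the linear part is, in suitable linear coordinates, multiplication by
`ω * I` on `ℂ` with `ω > 0`. -/
theorem NearbyPeriodic.exists_linear_normal_form (hper : NearbyPeriodic X)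
    (hX : HasStrictFDerivAt X A 0) (hX0 : X 0 = 0) (hdet : A.det ≠ 0) :
    ∃ (Φ : ℂ ≃L[ℝ] ℝ × ℝ) (ω : ℝ), 0 < ω ∧ ∀ ζ, A (Φ ζ) = Φ (ω * Complex.I * ζ) := by
  obtain ⟨a, ha⟩ : ∃ a, a = (A (1, 0)).1 := ⟨_, rfl⟩
  obtain ⟨b, hb⟩ : ∃ b, b = (A (0, 1)).1 := ⟨_, rfl⟩
  obtain ⟨c, hc⟩ : ∃ c, c = (A (1, 0)).2 := ⟨_, rfl⟩
  obtain ⟨d, hd⟩ : ∃ d, d = (A (0, 1)).2 := ⟨_, rfl⟩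
  have hA : ∀ z, A z = (a * z.1 + b * z.2, c * z.1 + d * z.2) := by
    intro z
    have hz : z = z.1 • ((1, 0) : ℝ × ℝ) + z.2 • ((0, 1) : ℝ × ℝ) := by ext <;> simp
    conv_lhs => rw [hz]
    rw [map_add, map_smul, map_smul]
    ext <;> simp [ha, hb, hc, hd] <;> ring
  rw [det_eq_of_apply hA] at hdet
  have hpos : 0 < a * d - b * c := by
    by_contra! hle
    exact not_nearbyPeriodic_of_det_neg hX hX0 hA (lt_of_le_of_ne hle hdet) hper
  have htr : a + d = 0 := by
    rcases lt_trichotomy (a + d) 0 with h | h | h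
    · exact absurd hper (not_nearbyPeriodic_of_trace_neg hX hX0 hA hpos h)
    · exact h
    · refine absurd hper.neg (not_nearbyPeriodic_of_trace_neg (a := -a) (b := -b) (c := -c)
        (d := -d) hX.fun_neg (by simp [hX0]) (fun z => ?_) (by linarith) (by linarith))
      rw [neg_apply, hA]
      ext <;> simp <;> ring
  have hda : d = -a := by linarith
  set ω := √(a * d - b * c) with hω
  have hω2 : ω ^ 2 = a * d - b * c := Real.sq_sqrt hpos.le
  have hω0 : 0 < ω := Real.sqrt_pos.2 hpos
  have hc0 : c ≠ 0 := by
    rintro rfl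
    rw [hda] at hpos
    nlinarith [sq_nonneg a]
  refine ⟨Complex.equivRealProdCLM.trans (planeEquiv 1 (a / ω) 0 (c / ω) ?_), ω, hω0, fun ζ => ?_⟩
  · simp [hc0, hω0.ne']
  · rw [hA]
    ext
    · simp
      field_simp
      linear_combination ζ.im * hω2 + ζ.im * a * hda
    · simp
      field_simp
      rw [hda]
      ring

end

/-! ### Analytic superposition operators and one-variable analytic functions -/

section

variable {K E F : Type*} [TopologicalSpace K] [CompactSpace K]
  [NormedAddCommGroup E] [NormedSpace ℝ E] [NormedAddCommGroup F] [NormedSpace ℝ F]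

/-- Pointwise application of a multilinear map to continuous functions on a compact space. -/
noncomputable def ContinuousMultilinearMap.liftContinuousMap (K : Type*) [TopologicalSpace K]
    [CompactSpace K] {n : ℕ} (p : ContinuousMultilinearMap ℝ (fun _ : Fin n => E) F) :
    ContinuousMultilinearMap ℝ (fun _ : Fin n => C(K, E)) C(K, F) :=
  MultilinearMap.mkContinuous
    { toFun := fun m => ⟨fun x => p fun i => m i x,
        p.cont.comp (continuous_pi fun i => (m i).continuous)⟩
      map_update_add' := fun m i f g => by
        ext x
        have key : ∀ h : C(K, E), (fun j => Function.update m i h j x) =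
            Function.update (fun j => m j x) i (h x) := fun h =>
          funext fun j => Function.apply_update (fun _ (g : C(K, E)) => g x) m i h j
        simp [key]
      map_update_smul' := fun m i t f => by
        ext x
        have key : ∀ h : C(K, E), (fun j => Function.update m i h j x) =
            Function.update (fun j => m j x) i (h x) := fun h =>
          funext fun j => Function.apply_update (fun _ (g : C(K, E)) => g x) m i h j
        simp [key] }
    ‖p‖ fun m => (ContinuousMap.norm_le _ (by positivity)).2 fun x =>
      (p.le_opNorm _).trans (by gcongr; exact (m _).norm_coe_le_norm x)

/-- Superposition operators are analytic: an analytic `f` acts analytically, by composition, on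
small continuous functions on a compact space. -/
theorem AnalyticAt.exists_superposition (K : Type*) [TopologicalSpace K] [CompactSpace K]
    [CompleteSpace F] {f : E → F} (hf : AnalyticAt ℝ f 0) :
    ∃ N : C(K, E) → C(K, F), AnalyticAt ℝ N 0 ∧ ∀ᶠ v in 𝓝 0, ∀ x, N v x = f (v x) := by
  obtain ⟨p, r, hp⟩ := hf
  let P : FormalMultilinearSeries ℝ C(K, E) C(K, F) := fun n => (p n).liftContinuousMap K
  have hle : p.radius ≤ P.radius := FormalMultilinearSeries.radius_le_of_le fun n =>
    MultilinearMap.mkContinuous_norm_le _ (norm_nonneg _) _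
  have hP := P.hasFPowerSeriesOnBall ((hp.r_pos.trans_le hp.r_le).trans_le hle)
  refine ⟨P.sum, hP.analyticAt, ?_⟩
  filter_upwards [Metric.eball_mem_nhds (0 : C(K, E)) hp.r_pos] with v hv x
  have h1 := P.hasSum (Metric.eball_subset_eball (hp.r_le.trans hle) hv)
  have h2 := h1.mapL (ContinuousMap.evalCLM ℝ x)
  have hvx : v x ∈ Metric.eball (0 : E) r := by
    rw [Metric.mem_eball, edist_zero_right] at hv ⊢
    refine lt_of_le_of_lt ?_ hv
    exact enorm_le_iff_norm_le.2 (v.norm_coe_le_norm x)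
  have h3 := hp.hasSum hvx
  rw [zero_add] at h3
  exact h2.unique h3

/-- A continuous family of linear maps, as a linear map to continuous functions. -/
noncomputable def ContinuousMap.flipCLM (A : C(K, E →L[ℝ] F)) : E →L[ℝ] C(K, F) :=
  LinearMap.mkContinuous
    { toFun := fun e => ⟨fun x => A x e, by fun_prop⟩
      map_add' := fun e e' => by ext x; simp
      map_smul' := fun t e => by ext x; simp } ‖A‖ fun e =>
    (ContinuousMap.norm_le _ (by positivity)).2 fun x =>
      ((A x).le_opNorm e).trans (by gcongr; exact A.norm_coe_le_norm x)

theorem ContinuousMap.flipCLM_apply (A : C(K, E →L[ℝ] F)) (e : E) (x : K) :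
    A.flipCLM e x = A x e := rfl

/-- The weighted integral `∫ t in a..b, w t • f (γ t)` as a functional of `f : C(K, F)`. -/
noncomputable def ContinuousMap.weightedIntegralCLM (F : Type*) [NormedAddCommGroup F]
    [NormedSpace ℝ F] (a b : ℝ) (w : C(ℝ, ℝ)) (γ : C(ℝ, K)) : C(K, F) →L[ℝ] F :=
  LinearMap.mkContinuous
    { toFun := fun f => ∫ t in a..b, w t • f (γ t)
      map_add' := fun f g => by
        simp only [ContinuousMap.add_apply, smul_add]
        exact intervalIntegral.integral_add (Continuous.intervalIntegrable (by fun_prop) _ _)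
          (Continuous.intervalIntegrable (by fun_prop) _ _)
      map_smul' := fun c f => by
        simp only [ContinuousMap.smul_apply, RingHom.id_apply, smul_comm _ c]
        exact intervalIntegral.integral_smul _ _ } (abs (∫ t in a..b, |w t|)) fun f => by
    have h := intervalIntegral.norm_integral_le_abs_of_norm_le (μ := MeasureTheory.volume)
      (f := fun t => w t • f (γ t)) (g := fun t => |w t| * ‖f‖) (a := a) (b := b)
      (.of_forall fun t => by
        rw [norm_smul, Real.norm_eq_abs]; gcongr; exact f.norm_coe_le_norm _)
      (Continuous.intervalIntegrable (by fun_prop) _ _)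
    rwa [intervalIntegral.integral_mul_const, abs_mul, abs_norm] at h

theorem ContinuousMap.weightedIntegralCLM_apply (a b : ℝ) (w : C(ℝ, ℝ)) (γ : C(ℝ, K))
    (f : C(K, F)) : weightedIntegralCLM F a b w γ f = ∫ t in a..b, w t • f (γ t) := rfl

end

/-- Hadamard's lemma for analytic functions: `f (r, s)` is divisible by `r` if it vanishes at
`r = 0`. The quotient is `∫ t in 0..1, ∂ᵣf (t * r, s)`, analytic because superposition operators
are. -/
theorem AnalyticAt.exists_eq_fst_smul {G F : Type*} [NormedAddCommGroup G] [NormedSpace ℝ G]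
    [NormedAddCommGroup F] [NormedSpace ℝ F] [CompleteSpace F] {f : ℝ × G → F}
    (hf : AnalyticAt ℝ f 0) (h0 : ∀ᶠ s in 𝓝 (0 : G), f (0, s) = 0) :
    ∃ β : ℝ × G → F, AnalyticAt ℝ β 0 ∧ (∀ᶠ p in 𝓝 0, f p = p.1 • β p) ∧
      ∀ᶠ s in 𝓝 (0 : G), β (0, s) = fderiv ℝ f (0, s) (1, 0) := by
  set g : ℝ × G → F := fun p => fderiv ℝ f p (1, 0) with hg
  have hga : AnalyticAt ℝ g 0 :=
    ((ContinuousLinearMap.apply ℝ F ((1, 0) : ℝ × G)).analyticAt _).comp hf.fderiv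
  obtain ⟨N, hN, hNg⟩ := hga.exists_superposition unitInterval
  let A : C(unitInterval, (ℝ × G) →L[ℝ] (ℝ × G)) :=
    ⟨fun t => (t : ℝ) • (ContinuousLinearMap.inl ℝ ℝ G ∘L ContinuousLinearMap.fst ℝ ℝ G) +
      ContinuousLinearMap.inr ℝ ℝ G ∘L ContinuousLinearMap.snd ℝ ℝ G, by fun_prop⟩
  have hA : ∀ (p : ℝ × G) (t : unitInterval), A.flipCLM p t = ((t : ℝ) * p.1, p.2) := by
    intro p t
    rw [ContinuousMap.flipCLM_apply]
    simp [A]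
  let I := ContinuousMap.weightedIntegralCLM F 0 1 (.const ℝ 1)
    (⟨projIcc (0 : ℝ) 1 zero_le_one, continuous_projIcc⟩ : C(ℝ, unitInterval))
  have hAt : Tendsto A.flipCLM (𝓝 0) (𝓝 0) := by
    simpa using A.flipCLM.continuous.tendsto 0
  have hβ : ∀ᶠ p in 𝓝 (0 : ℝ × G), I (N (A.flipCLM p)) = ∫ t in (0 : ℝ)..1, g (t * p.1, p.2) := by
    filter_upwards [hAt.eventually hNg] with p hp
    rw [ContinuousMap.weightedIntegralCLM_apply]
    refine intervalIntegral.integral_congr fun t ht => ?_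
    rw [uIcc_of_le zero_le_one] at ht
    simp [hp, hA, projIcc_of_mem zero_le_one ht]
  have hs : Tendsto (fun s : G => ((0 : ℝ), s)) (𝓝 0) (𝓝 0) :=
    Continuous.tendsto' (by fun_prop) _ _ rfl
  refine ⟨fun p => I (N (A.flipCLM p)), ?_, ?_, ?_⟩
  · refine (I.analyticAt _).comp (AnalyticAt.comp ?_ (A.flipCLM.analyticAt 0))
    simpa using hN
  · obtain ⟨ε, hε, hball⟩ := Metric.nhds_basis_ball.eventually_iff.1
      (hf.eventually_analyticAt.and hga.eventually_analyticAt)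
    have h0' : ∀ᶠ p in 𝓝 (0 : ℝ × G), f (0, p.2) = 0 := by
      have : Tendsto (fun p : ℝ × G => p.2) (𝓝 0) (𝓝 0) := continuous_snd.tendsto' _ _ rfl
      exact this.eventually h0
    filter_upwards [hβ, Metric.ball_mem_nhds 0 hε, h0'] with p hp hpε hp0
    have hmem : ∀ t ∈ uIcc (0 : ℝ) 1, (t * p.1, p.2) ∈ Metric.ball (0 : ℝ × G) ε := by
      intro t ht
      rw [uIcc_of_le zero_le_one] at ht
      rw [mem_ball_zero_iff] at hpε ⊢
      refine lt_of_le_of_lt ?_ hpε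
      rw [Prod.norm_mk, Prod.norm_def, norm_mul]
      gcongr
      exact mul_le_of_le_one_left (norm_nonneg _)
        (by rw [Real.norm_eq_abs, abs_of_nonneg ht.1]; exact ht.2)
    have hder : ∀ t ∈ uIcc (0 : ℝ) 1,
        HasDerivAt (fun t : ℝ => f (t * p.1, p.2)) (p.1 • g (t * p.1, p.2)) t := by
      intro t ht
      have h1 : HasDerivAt (fun t : ℝ => (t * p.1, p.2)) (p.1, 0) t :=
        (hasDerivAt_mul_const p.1).prodMk (hasDerivAt_const t p.2)
      have h2 := (hball (hmem t ht)).1.differentiableAt.hasFDerivAt.comp_hasDerivAt t h1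
      have h3 : ((p.1, 0) : ℝ × G) = p.1 • (1, 0) := by ext <;> simp
      rw [h3, map_smul] at h2
      exact h2
    have hcont : ContinuousOn (fun t : ℝ => g (t * p.1, p.2)) (uIcc 0 1) := fun t ht =>
      (ContinuousAt.comp (f := fun t : ℝ => (t * p.1, p.2)) (hball (hmem t ht)).2.continuousAt
        (by fun_prop)).continuousWithinAt
    have hint := intervalIntegral.integral_eq_sub_of_hasDerivAt hder
      (hcont.const_smul p.1).intervalIntegrable
    rw [intervalIntegral.integral_smul, ← hp] at hint
    simpa [hp0] using hint.symm
  · filter_upwards [hs.eventually hβ] with s hs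
    simp [hs, hg]

theorem hasFPowerSeriesAt_tsum_mul_pow {c : ℕ → ℝ} {C r : ℝ} (hr : 0 < r)
    (hc : ∀ n, |c n| ≤ C * r ^ n) :
    HasFPowerSeriesAt (fun x => ∑' n, c n * x ^ n) (FormalMultilinearSeries.ofScalars ℝ c) 0 ∧
      ∀ x, |x| < r⁻¹ → Summable fun n => |c n * x ^ n| := by
  have hsum : ∀ x, |x| < r⁻¹ → Summable fun n => |c n * x ^ n| := by
    intro x hx
    have hlt : r * |x| < 1 := by
      rw [← mul_inv_cancel₀ hr.ne']
      gcongr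
    refine Summable.of_nonneg_of_le (fun n => abs_nonneg _) (fun n => ?_)
      ((summable_geometric_of_lt_one (by positivity) hlt).mul_left C)
    rw [abs_mul, abs_pow, mul_pow, ← mul_assoc]
    gcongr
    exact hc n
  refine ⟨hasFPowerSeriesAt_iff.2 ?_, hsum⟩
  have : ∀ᶠ x : ℝ in 𝓝 0, |x| < r⁻¹ :=
    continuous_abs.continuousAt.eventually (gt_mem_nhds (by simpa using hr))
  filter_upwards [this] with x hx
  simpa [FormalMultilinearSeries.coeff_ofScalars, mul_comm] using (hsum x hx).of_abs.hasSum

/-- The power series coefficients of an analytic function grow at most geometrically. -/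
theorem AnalyticAt.exists_coeff {f : ℝ → ℝ} (hf : AnalyticAt ℝ f 0) :
    ∃ (a : ℕ → ℝ) (C r : ℝ), 0 < r ∧ 0 < C ∧ (∀ n, |a n| ≤ C * r ^ n) ∧
      ∀ᶠ x in 𝓝 0, HasSum (fun n => a n * x ^ n) (f x) := by
  obtain ⟨p, hp⟩ := hf
  obtain ⟨C, r, hC, hr, hle⟩ := p.le_mul_pow_of_radius_pos hp.radius_pos
  refine ⟨p.coeff, C, r, hr, hC, fun n => ?_, ?_⟩
  · simpa using hle n
  · simpa [mul_comm] using hasFPowerSeriesAt_iff.1 hp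

/-- An even analytic function is an analytic function of the square. -/
theorem AnalyticAt.exists_comp_sq_of_even {f : ℝ → ℝ} (hf : AnalyticAt ℝ f 0)
    (heven : ∀ᶠ x in 𝓝 0, f (-x) = f x) :
    ∃ S : ℝ → ℝ, AnalyticAt ℝ S 0 ∧ ∀ᶠ x in 𝓝 0, f x = S (x ^ 2) := by
  obtain ⟨a, C, r, hr, hC, hle, hsum⟩ := hf.exists_coeff
  have hb := hasFPowerSeriesAt_tsum_mul_pow (c := fun n => a (2 * n)) (C := C) (pow_pos hr 2)
    fun n => by rw [← pow_mul]; exact hle _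
  refine ⟨_, hb.1.analyticAt, ?_⟩
  have hneg : Tendsto (fun x : ℝ => -x) (𝓝 0) (𝓝 0) := continuous_neg.tendsto' _ _ neg_zero
  filter_upwards [heven, hsum, hneg.eventually hsum] with x hx h1 h2
  rw [hx] at h2
  have h3 := (h1.add h2).div_const 2
  rw [add_self_div_two] at h3
  have hinj : Function.Injective (fun n : ℕ => 2 * n) := mul_right_injective₀ two_ne_zero
  rw [← hinj.hasSum_iff] at h3
  · rw [← h3.tsum_eq]
    refine tsum_congr fun n => ?_
    simp [← pow_mul]
  · intro n hn
    have hodd : Odd n := by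
      rw [← Nat.not_even_iff_odd]
      rintro ⟨m, rfl⟩
      exact hn ⟨m, by ring⟩
    simp [hodd.neg_pow]

/-! ### Averages and primitives on the circle -/

theorem integral_sin_pow_even_two_pi (n : ℕ) :
    ∫ t in (0 : ℝ)..2 * Real.pi, Real.sin t ^ (2 * n) =
      2 * Real.pi * ∏ i ∈ Finset.range n, (2 * (i : ℝ) + 1) / (2 * i + 2) := by
  have h1 : ∀ a b : ℝ, IntervalIntegrable (fun t => Real.sin t ^ (2 * n))
      MeasureTheory.volume a b := fun a b => Continuous.intervalIntegrable (by fun_prop) _ _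
  have h2 : ∫ t in Real.pi..2 * Real.pi, Real.sin t ^ (2 * n) =
      ∫ t in (0 : ℝ)..Real.pi, Real.sin t ^ (2 * n) := by
    have := intervalIntegral.integral_comp_add_right (a := 0) (b := Real.pi)
      (fun t => Real.sin t ^ (2 * n)) Real.pi
    rw [zero_add, ← two_mul] at this
    rw [← this]
    simp [Real.sin_add_pi, pow_mul]
  rw [← intervalIntegral.integral_add_adjacent_intervals (h1 0 Real.pi) (h1 _ _), h2,
    integral_sin_pow_even]
  ring

/-- Inversion of the circle average: every analytic function of `ρ ^ 2` is the average over the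
circle of radius `ρ` of an even analytic function of one coordinate. On power series this divides
the `n`-th coefficient by the average of `sin ^ (2 * n)`, which is at least `2⁻ⁿ`. -/
theorem AnalyticAt.exists_even_circleAverage {s : ℝ → ℝ} (hs : AnalyticAt ℝ s 0) :
    ∃ k : ℝ → ℝ, AnalyticAt ℝ k 0 ∧ (∀ x, k (-x) = k x) ∧ k 0 = s 0 ∧
      ∀ᶠ ρ in 𝓝 (0 : ℝ),
        ∫ t in (0 : ℝ)..2 * Real.pi, k (ρ * Real.sin t) = 2 * Real.pi * s (ρ ^ 2) := by
  obtain ⟨a, C, r, hr, hC, hle, hsum⟩ := hs.exists_coeff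
  -- `m n` is the average of `sin ^ (2 * n)`
  set m : ℕ → ℝ := fun n => ∏ i ∈ Finset.range n, (2 * (i : ℝ) + 1) / (2 * i + 2) with hm
  have hm_lower : ∀ n, (1 / 2) ^ n ≤ m n := by
    intro n
    have h : ∏ _i ∈ Finset.range n, (1 / 2 : ℝ) = (1 / 2) ^ n := by simp
    rw [← h]
    refine Finset.prod_le_prod (fun _ _ => by positivity) fun i _ => ?_
    rw [div_le_div_iff₀ (by norm_num) (by positivity)]
    linarith
  have hm_pos : ∀ n, 0 < m n := fun n => lt_of_lt_of_le (by positivity) (hm_lower n)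
  set c : ℕ → ℝ := fun n => a n / m n with hc
  have hcle : ∀ n, |c n| ≤ C * (2 * r) ^ n := by
    intro n
    rw [hc, abs_div, abs_of_pos (hm_pos n), div_le_iff₀ (hm_pos n)]
    have h1 : (2 : ℝ) ^ n * (1 / 2) ^ n = 1 := by rw [← mul_pow]; norm_num
    have h2 : C * (2 * r) ^ n * (1 / 2) ^ n ≤ C * (2 * r) ^ n * m n := by
      gcongr
      exact hm_lower n
    calc |a n| ≤ C * r ^ n := hle n
      _ = C * (2 * r) ^ n * (1 / 2) ^ n := by rw [mul_pow]; linear_combination -C * r ^ n * h1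
      _ ≤ _ := h2
  have hr' : 0 < 2 * r := by positivity
  obtain ⟨hκ, hκsum⟩ := hasFPowerSeriesAt_tsum_mul_pow hr' hcle
  have hsq : Tendsto (fun x : ℝ => x ^ 2) (𝓝 0) (𝓝 0) :=
    (continuous_pow 2).tendsto' _ _ (by norm_num)
  refine ⟨fun x => ∑' n, c n * (x ^ 2) ^ n, ?_, fun x => by simp, ?_, ?_⟩
  · have h : AnalyticAt ℝ (fun x : ℝ => x ^ 2) 0 := analyticAt_id.pow 2
    exact AnalyticAt.comp_of_eq hκ.analyticAt h (by norm_num)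
  · have h1 := hsum.self_of_nhds
    have h2 : ∀ b : ℕ → ℝ, HasSum (fun n => b n * (0 : ℝ) ^ n) (b 0) := fun b => by
      convert! hasSum_single 0 fun n hn => ?_
      · simp
      · simp [hn]
    have h3 : (fun n => c n * (0 : ℝ) ^ n) = fun n => c n * (((0 : ℝ) ^ 2) ^ n) := by simp
    change ∑' n, c n * ((0 : ℝ) ^ 2) ^ n = s 0
    rw [h1.unique (h2 a), ← h3, (h2 c).tsum_eq]
    simp [hc, hm]
  · have hlt : ∀ᶠ x : ℝ in 𝓝 0, |x ^ 2| < (2 * r)⁻¹ :=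
      hsq.eventually (continuous_abs.continuousAt.eventually (gt_mem_nhds (by simpa using hr)))
    filter_upwards [hlt, hsq.eventually hsum] with ρ hρ hρs
    let f : ℕ → C(ℝ, ℝ) := fun n => ⟨fun t => c n * ((ρ * Real.sin t) ^ 2) ^ n, by fun_prop⟩
    have hf := intervalIntegral.hasSum_intervalIntegral_of_summable_norm (f := f) (a := 0)
      (b := 2 * Real.pi) (by
        refine Summable.of_nonneg_of_le (fun _ => norm_nonneg _) (fun n => ?_) (hκsum _ hρ)
        refine (ContinuousMap.norm_le _ (abs_nonneg _)).2 fun t => ?_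
        simp only [f, ContinuousMap.restrict_apply, ContinuousMap.coe_mk, Real.norm_eq_abs,
          abs_mul, abs_pow, mul_pow]
        gcongr
        have h1 := Real.abs_sin_le_one t
        exact mul_le_of_le_one_right (by positivity)
          (pow_le_one₀ (by positivity) (pow_le_one₀ (abs_nonneg _) h1)))
    have hterm : ∀ n, ∫ t in (0 : ℝ)..2 * Real.pi, f n t = 2 * Real.pi * (a n * (ρ ^ 2) ^ n) := by
      intro n
      have h1 : ∀ t, f n t = c n * (ρ ^ 2) ^ n * Real.sin t ^ (2 * n) := fun t => by
        simp only [f, ContinuousMap.coe_mk, mul_pow, pow_mul]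
        ring
      simp only [h1]
      rw [intervalIntegral.integral_const_mul, integral_sin_pow_even_two_pi]
      change a n / m n * (ρ ^ 2) ^ n * (2 * Real.pi * m n) = _
      have := (hm_pos n).ne'
      field_simp
    simp only [hterm] at hf
    exact hf.unique (hρs.mul_left _)

/-- For a `2π`-periodic function, convolution with the sawtooth `(t - π) / (2π)` inverts
differentiation up to the mean value. -/
theorem hasDerivAt_integral_sawtooth {F : Type*} [NormedAddCommGroup F] [NormedSpace ℝ F]
    [CompleteSpace F] {f : ℝ → F} (hf : Continuous f) (hper : Function.Periodic f (2 * Real.pi))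
    (α : ℝ) :
    HasDerivAt (fun α => ∫ t in (0 : ℝ)..2 * Real.pi, ((t - Real.pi) / (2 * Real.pi)) • f (α + t))
      (f α - (2 * Real.pi)⁻¹ • ∫ t in (0 : ℝ)..2 * Real.pi, f t) α := by
  have hpi : 2 * Real.pi ≠ 0 := by positivity
  have hg : Continuous fun t : ℝ => t • f t := by fun_prop
  set H : ℝ → F := fun x => ∫ t in (0 : ℝ)..x, t • f t with hH
  have hHd : ∀ x, HasDerivAt H (x • f x) x := fun x => hg.integral_hasStrictDerivAt 0 x |>.hasDerivAt
  set m := ∫ t in (0 : ℝ)..2 * Real.pi, f t with hm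
  have hrepr : (fun α => ∫ t in (0 : ℝ)..2 * Real.pi,
      ((t - Real.pi) / (2 * Real.pi)) • f (α + t)) =
      fun α => (2 * Real.pi)⁻¹ • (H (α + 2 * Real.pi) - H α - (α + Real.pi) • m) := by
    funext α
    have h1 : ∀ t : ℝ, ((t - Real.pi) / (2 * Real.pi)) • f (α + t) =
        (2 * Real.pi)⁻¹ • ((α + t) • f (α + t) - (α + Real.pi) • f (α + t)) := by
      intro t
      rw [← sub_smul, smul_smul]
      congr 1
      field_simp
      ring
    simp only [h1]
    have hsub := intervalIntegral.integral_comp_add_left (a := 0) (b := 2 * Real.pi)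
      (fun t => t • f t - (α + Real.pi) • f t) α
    rw [intervalIntegral.integral_smul, hsub, intervalIntegral.integral_sub
      (hg.intervalIntegrable _ _) (Continuous.intervalIntegrable (by fun_prop) _ _),
      intervalIntegral.integral_smul, add_zero]
    have h2 := hper.intervalIntegral_add_eq α 0
    rw [zero_add] at h2
    rw [h2, hH]
    simp only
    rw [intervalIntegral.integral_interval_sub_left (hg.intervalIntegrable _ _)
      (hg.intervalIntegrable _ _)]
  rw [hrepr]
  have h1 : HasDerivAt (fun α => H (α + 2 * Real.pi)) ((α + 2 * Real.pi) • f α) α := by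
    have := (hHd (α + 2 * Real.pi)).comp_add_const α (2 * Real.pi)
    rwa [hper α] at this
  have h2 : HasDerivAt (fun α : ℝ => (α + Real.pi) • m) m α := by
    simpa using ((hasDerivAt_id α).add_const Real.pi).smul_const m
  refine (((h1.fun_sub (hHd α)).fun_sub h2).const_smul ((2 * Real.pi)⁻¹)).congr_deriv ?_
  rw [smul_sub, ← sub_smul, smul_smul, add_sub_cancel_left, inv_mul_cancel₀ hpi, one_smul]

/-- The mean value of a function on the unit circle. -/
noncomputable def circleMean (F : Type*) [NormedAddCommGroup F] [NormedSpace ℝ F] :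
    C(Circle, F) →L[ℝ] F :=
  ContinuousMap.weightedIntegralCLM F 0 (2 * Real.pi) (.const ℝ (2 * Real.pi)⁻¹) Circle.exp

/-- The primitive with mean value zero of `f - circleMean F f`, for a function `f` on the unit
circle, written as the convolution of `f` with a sawtooth. -/
noncomputable def circlePrimitive (F : Type*) [NormedAddCommGroup F] [NormedSpace ℝ F] :
    C(Circle, F) →L[ℝ] C(Circle, F) :=
  LinearMap.mkContinuous
    { toFun := fun f => ⟨fun c => ∫ t in (0 : ℝ)..2 * Real.pi,
          ((t - Real.pi) / (2 * Real.pi)) • f (c * Circle.exp t),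
        intervalIntegral.continuous_parametric_intervalIntegral_of_continuous' (by fun_prop) _ _⟩
      map_add' := fun f g => by
        ext c
        simp only [ContinuousMap.add_apply, smul_add, ContinuousMap.coe_mk]
        exact intervalIntegral.integral_add (Continuous.intervalIntegrable (by fun_prop) _ _)
          (Continuous.intervalIntegrable (by fun_prop) _ _)
      map_smul' := fun r f => by
        ext c
        simp only [ContinuousMap.smul_apply, RingHom.id_apply, ContinuousMap.coe_mk, smul_comm _ r]
        exact intervalIntegral.integral_smul _ _ }
    (abs (∫ t in (0 : ℝ)..2 * Real.pi, |(t - Real.pi) / (2 * Real.pi)|)) fun f => by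
    refine (ContinuousMap.norm_le _ (by positivity)).2 fun c => ?_
    have h := intervalIntegral.norm_integral_le_abs_of_norm_le (μ := MeasureTheory.volume)
      (f := fun t => ((t - Real.pi) / (2 * Real.pi)) • f (c * Circle.exp t))
      (g := fun t => |(t - Real.pi) / (2 * Real.pi)| * ‖f‖) (a := 0) (b := 2 * Real.pi)
      (.of_forall fun t => by
        rw [norm_smul, Real.norm_eq_abs]; gcongr; exact f.norm_coe_le_norm _)
      (Continuous.intervalIntegrable (by fun_prop) _ _)
    rwa [intervalIntegral.integral_mul_const, abs_mul, abs_norm] at h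

section

variable {F : Type*} [NormedAddCommGroup F] [NormedSpace ℝ F]

theorem circleMean_apply (f : C(Circle, F)) :
    circleMean F f = (2 * Real.pi)⁻¹ • ∫ t in (0 : ℝ)..2 * Real.pi, f (Circle.exp t) :=
  intervalIntegral.integral_smul _ _

theorem circlePrimitive_apply (f : C(Circle, F)) (c : Circle) :
    circlePrimitive F f c = ∫ t in (0 : ℝ)..2 * Real.pi,
      ((t - Real.pi) / (2 * Real.pi)) • f (c * Circle.exp t) := rfl

theorem circlePrimitive_comp_mulLeft (f : C(Circle, F)) (α : Circle) :
    circlePrimitive F (f.comp (ContinuousMap.mulLeft α)) =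
      (circlePrimitive F f).comp (ContinuousMap.mulLeft α) := by
  ext c
  simp [circlePrimitive_apply, mul_assoc]

theorem Circle.periodic_comp_exp {α : Type*} (f : Circle → α) :
    Function.Periodic (fun t => f (Circle.exp t)) (2 * Real.pi) := fun t => by
  simp only [Circle.periodic_exp t]

theorem circleMean_comp_mulLeft (f : C(Circle, F)) (α : Circle) :
    circleMean F (f.comp (ContinuousMap.mulLeft α)) = circleMean F f := by
  obtain ⟨θ, rfl⟩ := Circle.exp_surjective α
  rw [circleMean_apply, circleMean_apply]
  congr 1
  have h := (Circle.periodic_comp_exp f).intervalIntegral_add_eq θ 0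
  rw [zero_add] at h
  rw [← h]
  have h2 := intervalIntegral.integral_comp_add_left (a := 0) (b := 2 * Real.pi)
    (fun t => f (Circle.exp t)) θ
  rw [add_zero] at h2
  rw [← h2]
  simp [Circle.exp_add]

@[simp]
theorem circleMean_const [CompleteSpace F] (e : F) : circleMean F (.const Circle e) = e := by
  rw [circleMean_apply]
  simp only [ContinuousMap.const_apply, intervalIntegral.integral_const, sub_zero, smul_smul]
  rw [inv_mul_cancel₀ (by positivity), one_smul]

@[simp]
theorem circlePrimitive_const [CompleteSpace F] (e : F) :
    circlePrimitive F (.const Circle e) = 0 := by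
  ext c
  rw [circlePrimitive_apply]
  simp only [ContinuousMap.const_apply, ContinuousMap.zero_apply]
  rw [intervalIntegral.integral_smul_const, intervalIntegral.integral_div,
    intervalIntegral.integral_sub (by simp) (by simp), integral_id]
  simp
  left
  ring

theorem hasDerivAt_circlePrimitive [CompleteSpace F] (f : C(Circle, F)) (α : ℝ) :
    HasDerivAt (fun α => circlePrimitive F f (Circle.exp α))
      (f (Circle.exp α) - circleMean F f) α := by
  rw [circleMean_apply]
  simpa only [circlePrimitive_apply, Circle.exp_add] using
    hasDerivAt_integral_sawtooth (f := fun t => f (Circle.exp t)) (by fun_prop)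
      (Circle.periodic_comp_exp f) α

end

theorem hasDerivAt_circleExp_mul (z : ℂ) :
    HasDerivAt (fun α : ℝ => (Circle.exp α : ℂ) * z) (Complex.I * z) 0 := by
  have h : HasDerivAt (fun α : ℝ => Complex.exp (α * Complex.I)) Complex.I 0 := by
    simpa using ((Complex.ofRealCLM.hasDerivAt (x := (0 : ℝ))).mul_const Complex.I).cexp
  simpa [Circle.coe_exp] using h.mul_const z

/-! ### Straightening the angle -/

theorem Complex.analyticAt_norm_sq (ζ : ℂ) : AnalyticAt ℝ (fun ζ : ℂ => ‖ζ‖ ^ 2) ζ :=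
  (contDiff_norm_sq ℝ (n := ⊤)).contDiffAt.analyticAt

/-- If `s (ρ ^ 2)` is the average of `k` over the circle of radius `ρ`, an analytic change of the
angle turns the field `I * ζ / k (Im ζ)` into `I * ζ / s (‖ζ‖ ^ 2)`. The change of angle is
`B / s` where `B` is a primitive, along the circles, of `k (Im ζ) - s (‖ζ‖ ^ 2)`; the sawtooth
formula for this primitive makes its analyticity at the origin visible. -/
theorem exists_angle_straightening {k s : ℝ → ℝ} (hk : AnalyticAt ℝ k 0) (hs : AnalyticAt ℝ s 0)
    (hs0 : 0 < s 0) (havg : ∀ᶠ ρ in 𝓝 (0 : ℝ),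
      ∫ t in (0 : ℝ)..2 * Real.pi, k (ρ * Real.sin t) = 2 * Real.pi * s (ρ ^ 2)) :
    ∃ Ψ : ℂ → ℂ, AnalyticAt ℝ Ψ 0 ∧ Ψ 0 = 0 ∧
      HasFDerivAt Ψ (ContinuousLinearMap.id ℝ ℂ) 0 ∧
      ∀ᶠ ζ in 𝓝 0, ‖Ψ ζ‖ = ‖ζ‖ ∧
        s (‖ζ‖ ^ 2) • fderiv ℝ Ψ ζ (Complex.I * ζ) = k ζ.im • (Complex.I * Ψ ζ) := by
  obtain ⟨N, hN, hNk⟩ := hk.exists_superposition Circle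
  let A : C(Circle, ℂ →L[ℝ] ℝ) :=
    ⟨fun c => Complex.imCLM ∘L ContinuousLinearMap.mul ℝ ℂ (c : ℂ), by fun_prop⟩
  have hA : ∀ ζ (c : Circle), A.flipCLM ζ c = ((c : ℂ) * ζ).im := fun ζ c => rfl
  have hAt : Tendsto A.flipCLM (𝓝 0) (𝓝 0) := A.flipCLM.continuous.tendsto' _ _ (map_zero _)
  have hNk' := hAt.eventually hNk
  let L : C(Circle, ℝ) →L[ℝ] ℝ := ContinuousMap.evalCLM ℝ (1 : Circle) ∘L circlePrimitive ℝ
  set B : ℂ → ℝ := fun ζ => L (N (A.flipCLM ζ)) with hB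
  have hBa : AnalyticAt ℝ B 0 := by
    refine (L.analyticAt _).comp (AnalyticAt.comp ?_ (A.flipCLM.analyticAt 0))
    simpa using hN
  have hB0 : B 0 = 0 := by
    have h : N (A.flipCLM 0) = .const Circle (k 0) := by
      ext c
      rw [hNk'.self_of_nhds c, hA]
      simp
    simp only [hB, h, L]
    simp
  have hsa : AnalyticAt ℝ (fun ζ : ℂ => s (‖ζ‖ ^ 2)) 0 :=
    AnalyticAt.comp_of_eq hs (Complex.analyticAt_norm_sq 0) (by simp)
  have hsne : ∀ᶠ ζ : ℂ in 𝓝 0, s (‖ζ‖ ^ 2) ≠ 0 :=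
    hsa.continuousAt.eventually_ne (by simpa using hs0.ne')
  set g : ℂ → ℂ := fun ζ => Complex.exp (Complex.I * ((B ζ / s (‖ζ‖ ^ 2) : ℝ) : ℂ)) with hg
  have hga : AnalyticAt ℝ g 0 := by
    have h1 : AnalyticAt ℝ (fun ζ : ℂ => B ζ / s (‖ζ‖ ^ 2)) 0 := hBa.div hsa hsne.self_of_nhds
    have h2 : AnalyticAt ℝ (fun ζ : ℂ => ((B ζ / s (‖ζ‖ ^ 2) : ℝ) : ℂ)) 0 :=
      (Complex.ofRealCLM.analyticAt _).comp h1
    exact ((analyticAt_cexp (z := _)).restrictScalars (𝕜 := ℝ)).comp (analyticAt_const.mul h2)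
  have hΨa : AnalyticAt ℝ (fun ζ => ζ * g ζ) 0 := analyticAt_id.mul hga
  refine ⟨fun ζ => ζ * g ζ, hΨa, by simp, ?_, ?_⟩
  · have := (hasFDerivAt_id (𝕜 := ℝ) (0 : ℂ)).mul hga.differentiableAt.hasFDerivAt
    refine this.congr_fderiv ?_
    ext
    simp [hg, hB0]
  have hnorm : Tendsto (fun ζ : ℂ => ‖ζ‖) (𝓝 0) (𝓝 0) := tendsto_norm_zero
  obtain ⟨ε, hε, hball⟩ := Metric.nhds_basis_ball.eventually_iff.1
    (hNk'.and ((hnorm.eventually havg).and (hsne.and hΨa.eventually_analyticAt)))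
  filter_upwards [Metric.ball_mem_nhds 0 hε] with ζ hζ
  rw [mem_ball_zero_iff] at hζ
  have hall : ∀ w : ℂ, ‖w‖ = ‖ζ‖ → ∀ c, N (A.flipCLM w) c = k ((c : ℂ) * w).im := by
    intro w hw c
    exact (hball (show w ∈ Metric.ball 0 ε by rwa [mem_ball_zero_iff, hw])).1 c
  obtain ⟨-, hav, hsζ, hΨζ⟩ := hball (show ζ ∈ Metric.ball 0 ε by rwa [mem_ball_zero_iff])
  set f := N (A.flipCLM ζ) with hf
  have hmean : circleMean ℝ f = s (‖ζ‖ ^ 2) := by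
    have h1 : f = (N (A.flipCLM (‖ζ‖ : ℂ))).comp (ContinuousMap.mulLeft (Circle.exp ζ.arg)) := by
      ext c
      rw [hf, hall ζ rfl, ContinuousMap.comp_apply, hall _ (by simp)]
      conv_lhs => rw [← Complex.norm_mul_exp_arg_mul_I ζ]
      simp only [ContinuousMap.coe_mulLeft, Circle.coe_mul, Circle.coe_exp]
      congr 2
      ring
    rw [h1, circleMean_comp_mulLeft, circleMean_apply]
    have h2 : ∀ t, N (A.flipCLM (‖ζ‖ : ℂ)) (Circle.exp t) = k (‖ζ‖ * Real.sin t) := by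
      intro t
      rw [hall _ (by simp), Circle.coe_exp, Complex.im_mul_ofReal, Complex.exp_ofReal_mul_I_im,
        mul_comm]
    simp only [h2]
    rw [hav, smul_eq_mul, inv_mul_cancel_left₀ (by positivity)]
  have hrotnorm : ∀ α : ℝ, ‖(Circle.exp α : ℂ) * ζ‖ = ‖ζ‖ := fun α => by simp
  have hBrot : ∀ α : ℝ, B (Circle.exp α * ζ) = circlePrimitive ℝ f (Circle.exp α) := by
    intro α
    have h1 : N (A.flipCLM (Circle.exp α * ζ)) = f.comp (ContinuousMap.mulLeft (Circle.exp α)) := by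
      ext c
      rw [hall _ (hrotnorm α), ContinuousMap.comp_apply, hf, hall ζ rfl]
      simp only [ContinuousMap.coe_mulLeft, Circle.coe_mul]
      congr 2
      ring
    simp only [hB, L]
    rw [h1, ContinuousLinearMap.comp_apply, circlePrimitive_comp_mulLeft]
    simp
  have hBd : HasDerivAt (fun α : ℝ => B (Circle.exp α * ζ)) (k ζ.im - s (‖ζ‖ ^ 2)) 0 := by
    simp only [hBrot]
    have := hasDerivAt_circlePrimitive f 0
    rwa [hmean, hf, hall ζ rfl, Circle.exp_zero, Circle.coe_one, one_mul] at this
  have hrot := hasDerivAt_circleExp_mul ζ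
  have hlhs : HasDerivAt (fun α : ℝ => (Circle.exp α * ζ) * g (Circle.exp α * ζ))
      (fderiv ℝ (fun ζ => ζ * g ζ) ζ (Complex.I * ζ)) 0 := by
    have h0 : (Circle.exp 0 : ℂ) * ζ = ζ := by simp
    have h1 : HasFDerivAt (fun ζ => ζ * g ζ) (fderiv ℝ (fun ζ => ζ * g ζ) ζ)
        ((Circle.exp 0 : ℂ) * ζ) := by
      rw [h0]
      exact hΨζ.differentiableAt.hasFDerivAt
    exact h1.comp_hasDerivAt (0 : ℝ) hrot
  have hgd : HasDerivAt (fun α : ℝ => g (Circle.exp α * ζ))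
      (g ζ * (Complex.I * (((k ζ.im - s (‖ζ‖ ^ 2)) / s (‖ζ‖ ^ 2) : ℝ) : ℂ))) 0 := by
    have h1 := ((hBd.div_const (s (‖ζ‖ ^ 2))).ofReal_comp.const_mul Complex.I).cexp
    simp only [hg, hrotnorm]
    simpa using h1
  have hrhs := hrot.mul hgd
  have heq := hlhs.unique hrhs
  refine ⟨?_, ?_⟩
  · rw [norm_mul, hg]
    simp only
    rw [mul_comm Complex.I, Complex.norm_exp_ofReal_mul_I, mul_one]
  · rw [heq]
    have hsC : (s (‖ζ‖ ^ 2) : ℂ) ≠ 0 := by exact_mod_cast hsζ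
    simp only [Circle.exp_zero, Circle.coe_one, one_mul, Complex.real_smul, Complex.ofReal_div,
      Complex.ofReal_sub]
    field_simp
    ring

/-! ### Lyapunov–Schmidt reduction for periodic orbits -/

/-- The analytic implicit function theorem at the origin, in the normalization where the equation
is `v = T p` to first order. -/
theorem AnalyticAt.exists_implicit {P V : Type*} [NormedAddCommGroup P] [NormedSpace ℝ P]
    [CompleteSpace P] [NormedAddCommGroup V] [NormedSpace ℝ V] [CompleteSpace V] {G : P × V → V}
    (hG : AnalyticAt ℝ G 0) (hG0 : G 0 = 0) {T : P →L[ℝ] V}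
    (hG' : HasFDerivAt G (ContinuousLinearMap.snd ℝ P V - T ∘L ContinuousLinearMap.fst ℝ P V) 0) :
    ∃ φ : P → V, AnalyticAt ℝ φ 0 ∧ φ 0 = 0 ∧ HasFDerivAt φ T 0 ∧
      ∀ᶠ q in 𝓝 (0 : P × V), G q = 0 ↔ q.2 = φ q.1 := by
  have hc : ContDiffAt ℝ ⊤ G 0 := hG.contDiffAt
  have hr : fderiv ℝ G 0 ∘L .inr ℝ P V = ContinuousLinearMap.id ℝ V := by
    rw [hG'.fderiv]; ext; simp
  have hl : fderiv ℝ G 0 ∘L .inl ℝ P V = -T := by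
    rw [hG'.fderiv]; ext; simp
  have hinv : (fderiv ℝ G 0 ∘L .inr ℝ P V).IsInvertible := by
    rw [hr]
    exact ⟨ContinuousLinearEquiv.refl ℝ V, rfl⟩
  have htop : (⊤ : WithTop ℕ∞) ≠ 0 := by simp
  refine ⟨hc.implicitFunction htop hinv, ?_, hc.implicitFunction_apply_self htop hinv, ?_, ?_⟩
  · exact (hc.contDiffAt_implicitFunction htop hinv).analyticAt
  · have h := (hc.hasStrictFDerivAt_implicitFunction htop hinv).hasFDerivAt
    rw [hl, hr] at h
    refine h.congr_fderiv ?_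
    ext x
    simp
  · filter_upwards [hc.eventually_apply_eq_iff_implicitFunction htop hinv] with q hq
    rw [hG0] at hq
    rw [hq, eq_comm]

theorem hasDerivAt_smul_zero {V : Type*} [NormedAddCommGroup V] [NormedSpace ℝ V] (w : V) :
    HasDerivAt (fun t : ℝ => t • w) w 0 := by
  simpa using (hasDerivAt_id (0 : ℝ)).smul_const w

theorem fderiv_superposition_apply {K E F : Type*} [TopologicalSpace K] [CompactSpace K]
    [NormedAddCommGroup E] [NormedSpace ℝ E] [NormedAddCommGroup F] [NormedSpace ℝ F]
    {f : E → F} {f' : E →L[ℝ] F} {N : C(K, E) → C(K, F)} (hN : DifferentiableAt ℝ N 0)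
    (hf : HasFDerivAt f f' 0) (hNf : ∀ᶠ v in 𝓝 0, ∀ x, N v x = f (v x)) (v : C(K, E)) (x : K) :
    fderiv ℝ N 0 v x = f' (v x) := by
  have h1 : HasDerivAt (fun t : ℝ => N (t • v) x) (fderiv ℝ N 0 v x) 0 := by
    have h := HasFDerivAt.comp_hasDerivAt (0 : ℝ) (l := N) (by
      rw [zero_smul]; exact hN.hasFDerivAt) (hasDerivAt_smul_zero v)
    exact (ContinuousMap.evalCLM ℝ x).hasFDerivAt.comp_hasDerivAt (0 : ℝ) h
  have h2 : HasDerivAt (fun t : ℝ => f (t • v x)) (f' (v x)) 0 :=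
    HasFDerivAt.comp_hasDerivAt (0 : ℝ) (by rwa [zero_smul]) (hasDerivAt_smul_zero (v x))
  refine h1.unique (h2.congr_of_eventuallyEq ?_)
  have ht : Tendsto (fun t : ℝ => t • v) (𝓝 0) (𝓝 0) :=
    (continuous_id.smul continuous_const).tendsto' _ _ (by simp)
  filter_upwards [ht.eventually hNf] with t h
  exact h x

theorem circleMean_smul (a : ℂ) (f : C(Circle, ℂ)) :
    circleMean ℂ (a • f) = a * circleMean ℂ f := by
  rw [circleMean_apply, circleMean_apply]
  simp only [ContinuousMap.smul_apply, smul_eq_mul]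
  rw [intervalIntegral.integral_const_mul, mul_smul_comm]

theorem circlePrimitive_smul (a : ℂ) (f : C(Circle, ℂ)) :
    circlePrimitive ℂ (a • f) = a • circlePrimitive ℂ f := by
  ext c
  simp only [circlePrimitive_apply, ContinuousMap.smul_apply, smul_eq_mul, ← mul_smul_comm]
  rw [intervalIntegral.integral_const_mul]

/-- The identification of vectors with constant functions on the circle. -/
noncomputable def circleConst : ℂ →L[ℝ] C(Circle, ℂ) :=
  ContinuousMap.flipCLM (.const Circle (ContinuousLinearMap.id ℝ ℂ))

@[simp]
theorem circleConst_apply (z : ℂ) (c : Circle) : circleConst z c = z := rfl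

theorem circleConst_eq (z : ℂ) : circleConst z = .const Circle z := rfl

/-- Pullback of a loop in the plane under the rotation by `α`, in a rotating frame. -/
noncomputable def circleRotate (α : Circle) (v : C(Circle, ℂ)) : C(Circle, ℂ) :=
  (α : ℂ) • v.comp (ContinuousMap.mulLeft α)

@[simp]
theorem circleRotate_apply (α : Circle) (v : C(Circle, ℂ)) (c : Circle) :
    circleRotate α v c = α * v (α * c) := rfl

theorem norm_circleRotate_le (α : Circle) (v : C(Circle, ℂ)) : ‖circleRotate α v‖ ≤ ‖v‖ :=
  (ContinuousMap.norm_le _ (norm_nonneg v)).2 fun c => by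
    rw [circleRotate_apply, norm_mul, Circle.norm_coe, one_mul]
    exact v.norm_coe_le_norm _

theorem circlePrimitive_circleRotate (α : Circle) (v : C(Circle, ℂ)) :
    circlePrimitive ℂ (circleRotate α v) = circleRotate α (circlePrimitive ℂ v) := by
  rw [circleRotate, circlePrimitive_smul, circlePrimitive_comp_mulLeft, circleRotate]

theorem circleMean_circleRotate (α : Circle) (v : C(Circle, ℂ)) :
    circleMean ℂ (circleRotate α v) = α * circleMean ℂ v := by
  rw [circleRotate, circleMean_smul, circleMean_comp_mulLeft]

/-- Lyapunov–Schmidt reduction. A loop `u c = c * v c` satisfies `u' = (1 + σ) * Y u` if and only if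
`v' = Λ`, where `Λ c = -I * v c + (1 + σ) * c⁻¹ * Y (c * v c)`. The equation
`v = z + circlePrimitive Λ`, in which the mean value of `Λ` is discarded, has a unique small
solution `v = φ (z, σ)`. It depends analytically on `(z, σ)` and is equivariant under rotations. -/
theorem exists_lyapunovSchmidt {Y : ℂ → ℂ} (hY : AnalyticAt ℝ Y 0) (hY0 : Y 0 = 0)
    (hY' : HasFDerivAt Y (ContinuousLinearMap.mul ℝ ℂ Complex.I) 0) :
    ∃ φ Λ : ℂ × ℝ → C(Circle, ℂ), AnalyticAt ℝ φ 0 ∧ φ 0 = 0 ∧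
      HasFDerivAt φ (circleConst ∘L ContinuousLinearMap.fst ℝ ℂ ℝ) 0 ∧ AnalyticAt ℝ Λ 0 ∧
      (∀ᶠ p in 𝓝 (0 : ℂ × ℝ), φ p = circleConst p.1 + circlePrimitive ℂ (Λ p) ∧
        (∀ c, Λ p c = -(Complex.I * φ p c) + (1 + p.2) * ((c⁻¹ : Circle) * Y (c * φ p c))) ∧
        ∀ α : Circle, φ (α * p.1, p.2) = circleRotate α (φ p) ∧
          Λ (α * p.1, p.2) = circleRotate α (Λ p)) ∧
      ∀ᶠ σ in 𝓝 (0 : ℝ), Λ (0, σ) = 0 ∧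
        fderiv ℝ Λ (0, σ) (1, 0) = circleConst (σ * Complex.I) := by
  obtain ⟨N, hN, hNY⟩ := hY.exists_superposition Circle
  have hN0 : N 0 = 0 := by
    ext c
    rw [hNY.self_of_nhds c]
    simp [hY0]
  let e : C(Circle, ℂ) := ⟨fun c => (c : ℂ), by fun_prop⟩
  let e' : C(Circle, ℂ) := ⟨fun c => ((c⁻¹ : Circle) : ℂ), by fun_prop⟩
  have he : ∀ c : Circle, e c = c := fun _ => rfl
  have he' : ∀ c : Circle, e' c = (c⁻¹ : Circle) := fun _ => rfl
  let M : C(Circle, ℂ) → C(Circle, ℂ) →L[ℝ] C(Circle, ℂ) := ContinuousLinearMap.mul ℝ _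
  have hM : ∀ f v c, M f v c = f c * v c := fun f v c => rfl
  -- the operator `v ↦ (c ↦ c⁻¹ * Y (c * v c))`
  set N₁ : C(Circle, ℂ) → C(Circle, ℂ) := fun v => M e' (N (M e v)) with hN₁
  have hN₁a : AnalyticAt ℝ N₁ 0 := by
    refine ((M e').analyticAt _).comp (AnalyticAt.comp ?_ ((M e).analyticAt 0))
    simpa using hN
  have hN₁d : HasFDerivAt N₁ (M (.const Circle Complex.I)) 0 := by
    have h1 : HasFDerivAt N (fderiv ℝ N 0) (M e 0) := by
      simpa using hN.differentiableAt.hasFDerivAt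
    have h2 := ((M e').hasFDerivAt).comp (0 : C(Circle, ℂ)) (h1.comp 0 (M e).hasFDerivAt)
    refine h2.congr_fderiv ?_
    ext v c
    simp only [ContinuousLinearMap.comp_apply, hM,
      fderiv_superposition_apply hN.differentiableAt hY' hNY, ContinuousMap.const_apply,
      ContinuousLinearMap.mul_apply']
    simp only [he, he', Circle.coe_inv]
    field_simp
  have hN₁0 : N₁ 0 = 0 := by simp [hN₁, hN0]
  have hN₁Y : ∀ᶠ v in 𝓝 0, ∀ c, N₁ v c = (c⁻¹ : Circle) * Y (c * v c) := by
    have : Tendsto (M e) (𝓝 0) (𝓝 0) := (M e).continuous.tendsto' _ _ (map_zero _)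
    filter_upwards [this.eventually hNY] with v hv c
    simp only [hN₁, hM, hv, he, he']
  -- the right-hand side of `v' = Λ` as a function of `((z, σ), v)`; its derivative at `0` vanishes
  set Θ : (ℂ × ℝ) × C(Circle, ℂ) → C(Circle, ℂ) := fun q =>
    -(M (.const Circle Complex.I) q.2) + (1 + q.1.2) • N₁ q.2 with hΘ
  have hΘa : AnalyticAt ℝ Θ 0 := by
    refine AnalyticAt.fun_add ?_ (AnalyticAt.fun_smul ?_ ?_)
    · exact (((M _).analyticAt _).comp analyticAt_snd).neg
    · exact analyticAt_const.add (analyticAt_snd.comp analyticAt_fst)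
    · exact AnalyticAt.comp_of_eq (g := N₁) (f := fun q : (ℂ × ℝ) × C(Circle, ℂ) => q.2) hN₁a
        analyticAt_snd rfl
  have hΘd : HasFDerivAt Θ (0 : (ℂ × ℝ) × C(Circle, ℂ) →L[ℝ] C(Circle, ℂ)) 0 := by
    have hsnd : HasFDerivAt (fun q : (ℂ × ℝ) × C(Circle, ℂ) => q.2)
      (ContinuousLinearMap.snd ℝ (ℂ × ℝ) C(Circle, ℂ)) 0 := hasFDerivAt_snd
    have hσ : HasFDerivAt (fun q : (ℂ × ℝ) × C(Circle, ℂ) => 1 + q.1.2)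
      (ContinuousLinearMap.snd ℝ ℂ ℝ ∘L ContinuousLinearMap.fst ℝ (ℂ × ℝ) C(Circle, ℂ)) 0 :=
      (hasFDerivAt_snd.comp (0 : (ℂ × ℝ) × C(Circle, ℂ)) hasFDerivAt_fst).const_add 1
    have h1 := ((M (.const Circle Complex.I)).hasFDerivAt.comp
      (0 : (ℂ × ℝ) × C(Circle, ℂ)) hsnd).neg
    have h2 := hσ.smul (HasFDerivAt.comp (0 : (ℂ × ℝ) × C(Circle, ℂ)) hN₁d hsnd)
    refine (h1.add h2).congr_fderiv ?_
    ext q c <;> simp [hN₁0]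
  have hΘ0 : ∀ σ : ℝ, Θ ((0, σ), 0) = 0 := fun σ => by simp [hΘ, hN₁0]
  set G : (ℂ × ℝ) × C(Circle, ℂ) → C(Circle, ℂ) := fun q =>
    q.2 - circleConst q.1.1 - circlePrimitive ℂ (Θ q) with hG
  have hGa : AnalyticAt ℝ G 0 := by
    refine (analyticAt_snd.sub ?_).sub ?_
    · exact (circleConst.analyticAt _).comp (analyticAt_fst.comp analyticAt_fst)
    · exact ((circlePrimitive ℂ).analyticAt _).comp hΘa
  have hG0 : ∀ σ : ℝ, G ((0, σ), 0) = 0 := fun σ => by simp [hG, hΘ0]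
  have hGd : HasFDerivAt G (ContinuousLinearMap.snd ℝ (ℂ × ℝ) C(Circle, ℂ) -
      (circleConst ∘L ContinuousLinearMap.fst ℝ ℂ ℝ) ∘L
        ContinuousLinearMap.fst ℝ (ℂ × ℝ) C(Circle, ℂ)) 0 := by
    have h1 : HasFDerivAt (fun q : (ℂ × ℝ) × C(Circle, ℂ) => circleConst q.1.1)
        ((circleConst ∘L ContinuousLinearMap.fst ℝ ℂ ℝ) ∘L
        ContinuousLinearMap.fst ℝ (ℂ × ℝ) C(Circle, ℂ)) 0 :=
      ((circleConst ∘L ContinuousLinearMap.fst ℝ ℂ ℝ) ∘L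
        ContinuousLinearMap.fst ℝ (ℂ × ℝ) C(Circle, ℂ)).hasFDerivAt
    have h2 := (circlePrimitive ℂ).hasFDerivAt.comp (0 : (ℂ × ℝ) × C(Circle, ℂ)) hΘd
    refine ((hasFDerivAt_snd.sub h1).sub h2).congr_fderiv ?_
    rw [ContinuousLinearMap.comp_zero, sub_zero]
  obtain ⟨φ, hφa, hφ0, hφd, hφiff⟩ := hGa.exists_implicit (hG0 0) hGd
  have hgraph : Tendsto (fun p => (p, φ p)) (𝓝 (0 : ℂ × ℝ)) (𝓝 0) := by
    have := (continuousAt_id (x := (0 : ℂ × ℝ))).prodMk hφa.continuousAt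
    rw [ContinuousAt, hφ0] at this
    exact this
  set Λ : ℂ × ℝ → C(Circle, ℂ) := fun p => Θ (p, φ p) with hΛ
  have hΛa : AnalyticAt ℝ Λ 0 :=
    AnalyticAt.comp_of_eq hΘa (analyticAt_id.prod hφa) (by simp [hφ0])
  have hΛapp : ∀ q : (ℂ × ℝ) × C(Circle, ℂ), (∀ c, N₁ q.2 c = (c⁻¹ : Circle) * Y (c * q.2 c)) →
      ∀ c, Θ q c = -(Complex.I * q.2 c) + (1 + q.1.2) * ((c⁻¹ : Circle) * Y (c * q.2 c)) := by
    intro q hq c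
    simp only [hΘ, ContinuousMap.add_apply, ContinuousMap.neg_apply, ContinuousMap.smul_apply, hM,
      hq, ContinuousMap.const_apply, Complex.real_smul, Complex.ofReal_add, Complex.ofReal_one]
  have hsol : ∀ᶠ p in 𝓝 (0 : ℂ × ℝ), φ p = circleConst p.1 + circlePrimitive ℂ (Λ p) := by
    filter_upwards [hgraph.eventually hφiff] with p hp
    have h := hp.2 rfl
    simp only [hG] at h
    rw [sub_sub, sub_eq_zero] at h
    exact h
  refine ⟨φ, Λ, hφa, hφ0, hφd, hΛa, ?_, ?_⟩
  · have hsnd0 : Tendsto (fun q : (ℂ × ℝ) × C(Circle, ℂ) => q.2) (𝓝 0) (𝓝 0) :=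
      continuous_snd.tendsto' _ _ rfl
    -- a ball on which uniqueness holds is invariant under all rotations simultaneously
    obtain ⟨ε, hε, hball⟩ := Metric.nhds_basis_ball.eventually_iff.1
      (hφiff.and (hsnd0.eventually hN₁Y))
    filter_upwards [hgraph.eventually (Metric.ball_mem_nhds 0 hε), hsol] with p hp hps
    have happ := hΛapp (p, φ p) (hball hp).2
    refine ⟨hps, happ, fun α => ?_⟩
    have hmem : (((α : ℂ) * p.1, p.2), circleRotate α (φ p)) ∈
        Metric.ball (0 : (ℂ × ℝ) × C(Circle, ℂ)) ε := by
      rw [dist_zero_right] at hp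
      rw [mem_ball_zero_iff]
      refine lt_of_le_of_lt ?_ hp
      simp only [Prod.norm_def, norm_mul, Circle.norm_coe, one_mul]
      exact max_le_max le_rfl (norm_circleRotate_le α _)
    have hrot : Θ (((α : ℂ) * p.1, p.2), circleRotate α (φ p)) = circleRotate α (Λ p) := by
      ext c
      rw [hΛapp _ (hball hmem).2]
      change _ = (α : ℂ) * Θ (p, φ p) (α * c)
      rw [happ]
      simp only [circleRotate_apply, mul_inv_rev, Circle.coe_mul, Circle.coe_inv]
      rw [show (c : ℂ) * (α * φ p (α * c)) = α * c * φ p (α * c) by ring]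
      field_simp
    have hGrot : G (((α : ℂ) * p.1, p.2), circleRotate α (φ p)) = 0 := by
      simp only [hG]
      rw [hrot, circlePrimitive_circleRotate, sub_sub, sub_eq_zero]
      conv_lhs => rw [hps]
      ext c
      simp [mul_add]
    have hφrot := (hball hmem).1.1 hGrot
    simp only at hφrot
    refine ⟨hφrot.symm, ?_⟩
    rw [← hrot, hφrot]
  · have hax : Tendsto (fun σ : ℝ => ((0 : ℂ), σ)) (𝓝 0) (𝓝 0) :=
      Continuous.tendsto' (by fun_prop) _ _ rfl
    have hax' : Tendsto (fun σ : ℝ => (((0 : ℂ), σ), (0 : C(Circle, ℂ)))) (𝓝 0) (𝓝 0) :=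
      Continuous.tendsto' (by fun_prop) _ _ rfl
    have hsmall : ∀ᶠ σ : ℝ in 𝓝 0, |σ| * ‖circlePrimitive ℂ‖ < 1 := by
      have : Tendsto (fun σ : ℝ => |σ| * ‖circlePrimitive ℂ‖) (𝓝 0) (𝓝 0) :=
        Continuous.tendsto' (by fun_prop) _ _ (by simp)
      exact this.eventually (gt_mem_nhds one_pos)
    filter_upwards [hsmall, hax'.eventually hφiff,
      hax.eventually (hφa.eventually_analyticAt.and (hΛa.eventually_analyticAt.and
        hsol.eventually_nhds))] with σ hσ hσiff ⟨hφσ, hΛσ, hsolσ⟩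
    have hφz : φ (0, σ) = 0 := (hσiff.1 (hG0 σ)).symm
    refine ⟨by simp [hΛ, hφz, hΘ0], ?_⟩
    -- `w` is the derivative of `φ` in the direction of `z = 1`
    set w := fderiv ℝ φ (0, σ) (1, 0) with hw
    have hline : HasDerivAt (fun r : ℝ => ((r : ℂ), σ)) (1, 0) 0 :=
      (Complex.ofRealCLM.hasDerivAt (x := (0 : ℝ))).prodMk (hasDerivAt_const _ _)
    have hvd : HasDerivAt (fun r : ℝ => φ ((r : ℂ), σ)) w 0 :=
      HasFDerivAt.comp_hasDerivAt (0 : ℝ) (by simpa using hφσ.differentiableAt.hasFDerivAt) hline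
    have hΛd₁ : HasDerivAt (fun r : ℝ => Λ ((r : ℂ), σ)) (fderiv ℝ Λ (0, σ) (1, 0)) 0 :=
      HasFDerivAt.comp_hasDerivAt (0 : ℝ) (by simpa using hΛσ.differentiableAt.hasFDerivAt) hline
    have hΛd₂ : HasDerivAt (fun r : ℝ => Λ ((r : ℂ), σ))
        (σ • M (.const Circle Complex.I) w) 0 := by
      have h1 := ((M (.const Circle Complex.I)).hasFDerivAt.comp_hasDerivAt (0 : ℝ) hvd).neg
      have h2 := (HasFDerivAt.comp_hasDerivAt (0 : ℝ) (l := N₁)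
        (by simpa [hφz] using hN₁d) hvd).const_smul (1 + σ)
      refine (h1.add h2).congr_deriv ?_
      rw [add_smul, one_smul, neg_add_cancel_left]
    have hΛd := hΛd₁.unique hΛd₂
    have hwsol : w = circleConst 1 + circlePrimitive ℂ (σ • M (.const Circle Complex.I) w) := by
      have h1 : HasDerivAt (fun r : ℝ => circleConst (r : ℂ)) (circleConst 1) 0 :=
        circleConst.hasFDerivAt.comp_hasDerivAt (0 : ℝ)
          (Complex.ofRealCLM.hasDerivAt (x := (0 : ℝ)))
      have h2 := (circlePrimitive ℂ).hasFDerivAt.comp_hasDerivAt (0 : ℝ) hΛd₂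
      refine hvd.unique ((h1.add h2).congr_of_eventuallyEq ?_)
      have ht : Tendsto (fun r : ℝ => ((r : ℂ), σ)) (𝓝 0) (𝓝 (0, σ)) :=
        Continuous.tendsto' (by fun_prop) _ _ (by simp)
      filter_upwards [ht.eventually hsolσ] with r hr
      exact hr
    have hw1 : w = circleConst 1 := by
      have h1 : M (.const Circle Complex.I) (circleConst 1) = .const Circle Complex.I := by
        ext c
        simp [hM]
      have h2 : w - circleConst 1 =
          σ • circlePrimitive ℂ (M (.const Circle Complex.I) (w - circleConst 1)) := by
        rw [map_sub, h1, map_sub, circlePrimitive_const, sub_zero, ← map_smul]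
        exact sub_eq_of_eq_add' hwsol
      have h3 : ‖M (.const Circle Complex.I) (w - circleConst 1)‖ ≤ ‖w - circleConst 1‖ :=
        (ContinuousMap.norm_le _ (norm_nonneg _)).2 fun c => by
          rw [hM, norm_mul, ContinuousMap.const_apply, Complex.norm_I, one_mul]
          exact ContinuousMap.norm_coe_le_norm _ c
      have h4 : ‖w - circleConst 1‖ ≤ |σ| * ‖circlePrimitive ℂ‖ * ‖w - circleConst 1‖ := by
        conv_lhs => rw [h2]
        rw [norm_smul, Real.norm_eq_abs, mul_assoc]
        gcongr
        exact ((circlePrimitive ℂ).le_opNorm _).trans (by gcongr)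
      have h5 : ‖w - circleConst 1‖ = 0 := by
        nlinarith [norm_nonneg (w - circleConst 1)]
      exact sub_eq_zero.1 (norm_eq_zero.1 h5)
    rw [hΛd, hw1]
    ext c
    simp [hM]

/-! ### The rotation normal form with a radial defect -/

/-- Analytic normal form up to a radial defect: an analytic `h` tangent to the identity conjugates
rotation to `Y`, after a radial change of time `1 + S (‖z‖ ^ 2)` and up to a radial term
`β ‖z‖ * z`. The function `S` comes from solving the imaginary part of the Lyapunov–Schmidt
bifurcation equation, and `β` is the real part that remains. Since `h` is obtained from a reduction
over the full plane of parameters `z`, it is analytic at the origin. -/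
theorem exists_rotation_normal_form {Y : ℂ → ℂ} (hY : AnalyticAt ℝ Y 0) (hY0 : Y 0 = 0)
    (hY' : HasFDerivAt Y (ContinuousLinearMap.mul ℝ ℂ Complex.I) 0) :
    ∃ (h : ℂ → ℂ) (S β : ℝ → ℝ), AnalyticAt ℝ h 0 ∧ h 0 = 0 ∧
      HasFDerivAt h (ContinuousLinearMap.id ℝ ℂ) 0 ∧ AnalyticAt ℝ S 0 ∧ S 0 = 0 ∧
      AnalyticAt ℝ β 0 ∧ ∀ᶠ z in 𝓝 (0 : ℂ),
        fderiv ℝ h z (Complex.I * z) = (1 + S (‖z‖ ^ 2)) • Y (h z) - β ‖z‖ • z := by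
  obtain ⟨φ, Λ, hφa, hφ0, hφd, hΛa, hall, hax⟩ := exists_lyapunovSchmidt hY hY0 hY'
  -- the bifurcation function, on real `z`
  set f : ℝ × ℝ → ℂ := fun p => circleMean ℂ (Λ ((p.1 : ℂ), p.2)) with hf
  have hιa : ∀ p : ℝ × ℝ, AnalyticAt ℝ (fun p : ℝ × ℝ => ((p.1 : ℂ), p.2)) p := fun p =>
    ((Complex.ofRealCLM.analyticAt _).comp analyticAt_fst).prod analyticAt_snd
  have hι : Tendsto (fun p : ℝ × ℝ => ((p.1 : ℂ), p.2)) (𝓝 0) (𝓝 0) :=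
    Continuous.tendsto' (by fun_prop) _ _ (by simp)
  have hfa : AnalyticAt ℝ f 0 :=
    ((circleMean ℂ).analyticAt _).comp (AnalyticAt.comp_of_eq hΛa (hιa 0) (by simp))
  have hf0 : ∀ᶠ σ in 𝓝 (0 : ℝ), f (0, σ) = 0 := by
    filter_upwards [hax] with σ hσ
    simp [hf, hσ.1]
  obtain ⟨B, hBa, hBf, hB0⟩ := hfa.exists_eq_fst_smul hf0
  have hBσ : ∀ᶠ σ in 𝓝 (0 : ℝ), B (0, σ) = σ * Complex.I := by
    have ht : Tendsto (fun σ : ℝ => ((0 : ℂ), σ)) (𝓝 0) (𝓝 0) :=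
      Continuous.tendsto' (by fun_prop) _ _ rfl
    filter_upwards [hax, hB0, ht.eventually hΛa.eventually_analyticAt] with σ hσ hBσ hΛσ
    rw [hBσ]
    have h1 : HasFDerivAt (fun p : ℝ × ℝ => ((p.1 : ℂ), p.2))
        ((Complex.ofRealCLM ∘L ContinuousLinearMap.fst ℝ ℝ ℝ).prod
          (ContinuousLinearMap.snd ℝ ℝ ℝ)) ((0 : ℝ), σ) :=
      ((Complex.ofRealCLM ∘L ContinuousLinearMap.fst ℝ ℝ ℝ).prod
          (ContinuousLinearMap.snd ℝ ℝ ℝ)).hasFDerivAt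
    have h2 : HasFDerivAt Λ (fderiv ℝ Λ (0, σ)) (((0 : ℝ) : ℂ), σ) := by
      simpa using hΛσ.differentiableAt.hasFDerivAt
    have h3 : HasFDerivAt f _ ((0 : ℝ), σ) := (circleMean ℂ).hasFDerivAt.comp ((0 : ℝ), σ)
      (HasFDerivAt.comp (f := fun p : ℝ × ℝ => ((p.1 : ℂ), p.2)) ((0 : ℝ), σ) h2 h1)
    rw [h3.fderiv]
    simp [hσ.2, circleConst_eq]
  -- the imaginary part of the bifurcation equation determines the change of time
  set q : ℝ × ℝ → ℝ := fun p => (B p).im with hq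
  have hqa : AnalyticAt ℝ q 0 := (Complex.imCLM.analyticAt _).comp hBa
  have hqσ : ∀ᶠ σ in 𝓝 (0 : ℝ), q (0, σ) = σ := by
    filter_upwards [hBσ] with σ hσ
    simp [hq, hσ]
  have hq0 : q 0 = 0 := hqσ.self_of_nhds
  have hqd : fderiv ℝ q 0 (0, 1) = 1 := by
    have h1 : HasDerivAt (fun σ : ℝ => ((0 : ℝ), σ)) (0, 1) 0 :=
      (hasDerivAt_const _ _).prodMk (hasDerivAt_id _)
    have h2 : HasDerivAt (fun σ : ℝ => q (0, σ)) (fderiv ℝ q 0 (0, 1)) 0 :=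
      HasFDerivAt.comp_hasDerivAt (0 : ℝ) (l := q) hqa.differentiableAt.hasFDerivAt h1
    exact h2.unique ((hasDerivAt_id (0 : ℝ)).congr_of_eventuallyEq hqσ)
  have hqd' : HasFDerivAt q (ContinuousLinearMap.snd ℝ ℝ ℝ -
      (-(fderiv ℝ q 0 ∘L ContinuousLinearMap.inl ℝ ℝ ℝ)) ∘L ContinuousLinearMap.fst ℝ ℝ ℝ) 0 := by
    refine hqa.differentiableAt.hasFDerivAt.congr_fderiv ?_
    ext
    · simp
    · simp [hqd]
      exact map_zero _
  obtain ⟨σ, hσa, hσ0, -, hσiff⟩ := hqa.exists_implicit hq0 hqd'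
  have hgraph : Tendsto (fun r => (r, σ r)) (𝓝 0) (𝓝 0) := by
    have := (continuousAt_id (x := (0 : ℝ))).prodMk hσa.continuousAt
    rw [ContinuousAt, hσ0] at this
    exact this
  have hneg : Tendsto (fun r : ℝ => -r) (𝓝 0) (𝓝 0) := continuous_neg.tendsto' _ _ neg_zero
  have hσq : ∀ᶠ r in 𝓝 (0 : ℝ), q (r, σ r) = 0 := by
    filter_upwards [hgraph.eventually hσiff] with r hr
    exact hr.2 rfl
  -- evenness comes from equivariance under the rotation by `π`
  have hBeven : ∀ᶠ p in 𝓝 (0 : ℝ × ℝ), B (-p.1, p.2) = B p := by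
    have hn : Tendsto (fun p : ℝ × ℝ => (-p.1, p.2)) (𝓝 0) (𝓝 0) :=
      Continuous.tendsto' (by fun_prop) _ _ (by simp)
    filter_upwards [hBf, hn.eventually hBf, hι.eventually hall] with p h1 h2 h3
    rcases eq_or_ne p.1 0 with h0 | h0
    · have : ((-p.1, p.2) : ℝ × ℝ) = p := by ext <;> simp [h0]
      rw [this]
    · have h4 := (h3.2.2 (Circle.exp Real.pi)).2
      have h5 : f (-p.1, p.2) = -f p := by
        simp only [hf]
        have h6 : ((Circle.exp Real.pi : Circle) : ℂ) = -1 := by simp [Circle.coe_exp]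
        have h7 := circleMean_circleRotate (Circle.exp Real.pi) (Λ ((p.1 : ℂ), p.2))
        rw [← h4, h6] at h7
        simpa using h7
      rw [h1, h2] at h5
      simp only [neg_smul, neg_inj] at h5
      exact smul_right_injective ℂ h0 h5
  have hσeven : ∀ᶠ r in 𝓝 (0 : ℝ), σ (-r) = σ r := by
    have hn : Tendsto (fun r : ℝ => (-r, σ r)) (𝓝 0) (𝓝 0) := by
      have := hneg.prodMk_nhds (hgraph.snd_nhds)
      exact this
    filter_upwards [hσq, hgraph.eventually hBeven, hn.eventually hσiff] with r h1 h2 h3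
    have h4 : q (-r, σ r) = 0 := by
      rw [← h1]
      exact congrArg Complex.im h2
    exact (h3.1 h4).symm
  obtain ⟨S, hSa, hS⟩ := hσa.exists_comp_sq_of_even hσeven
  have hS0 : S 0 = 0 := by
    have := hS.self_of_nhds
    rw [hσ0] at this
    simpa using this.symm
  have hψa : AnalyticAt ℝ (fun z : ℂ => (z, S (‖z‖ ^ 2))) 0 :=
    analyticAt_id.prod (AnalyticAt.comp_of_eq hSa (Complex.analyticAt_norm_sq 0) (by simp))
  have hψ0 : ((0 : ℂ), S (‖(0 : ℂ)‖ ^ 2)) = 0 := by simp [hS0]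
  let ev : C(Circle, ℂ) →L[ℝ] ℂ := ContinuousMap.evalCLM ℝ (1 : Circle)
  have hha : AnalyticAt ℝ (fun z : ℂ => φ (z, S (‖z‖ ^ 2)) 1) 0 :=
    (ev.analyticAt _).comp (AnalyticAt.comp_of_eq hφa hψa hψ0)
  refine ⟨fun z => φ (z, S (‖z‖ ^ 2)) 1, S, fun r => (B (r, σ r)).re, hha, ?_, ?_, hSa, hS0, ?_, ?_⟩
  · simp only [hψ0, hφ0]
    rfl
  · have h1 : HasFDerivAt φ (circleConst ∘L ContinuousLinearMap.fst ℝ ℂ ℝ)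
        ((0 : ℂ), S (‖(0 : ℂ)‖ ^ 2)) := by rwa [hψ0]
    have h2 : HasFDerivAt (fun z : ℂ => (z, S (‖z‖ ^ 2))) ((ContinuousLinearMap.id ℝ ℂ).prod
        (fderiv ℝ (fun z : ℂ => S (‖z‖ ^ 2)) 0)) 0 :=
      (hasFDerivAt_id _).prodMk (AnalyticAt.comp_of_eq hSa (Complex.analyticAt_norm_sq 0)
        (by simp)).differentiableAt.hasFDerivAt
    refine (ev.hasFDerivAt.comp (0 : ℂ) (h1.comp 0 h2)).congr_fderiv ?_
    ext
    simp [ev]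
  · have h1 : AnalyticAt ℝ (fun r => B (r, σ r)) 0 :=
      AnalyticAt.comp_of_eq hBa (analyticAt_id.prod hσa) (by simp [hσ0])
    exact (Complex.reCLM.analyticAt _).comp h1
  have hnorm : Tendsto (fun z : ℂ => ‖z‖) (𝓝 0) (𝓝 0) := tendsto_norm_zero
  have hψt : Tendsto (fun z : ℂ => (z, S (‖z‖ ^ 2))) (𝓝 0) (𝓝 0) := by
    have := hψa.continuousAt
    rwa [ContinuousAt, hψ0] at this
  have hψt' : Tendsto (fun z : ℂ => ((‖z‖ : ℂ), S (‖z‖ ^ 2))) (𝓝 0) (𝓝 0) := by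
    have h1 : Tendsto (fun z : ℂ => (‖z‖ : ℂ)) (𝓝 0) (𝓝 0) :=
      Continuous.tendsto' (by fun_prop) _ _ (by simp)
    exact h1.prodMk_nhds hψt.snd_nhds
  filter_upwards [hψt.eventually hall, hψt'.eventually hall, hnorm.eventually hS,
    hnorm.eventually hσq, (hgraph.comp hnorm).eventually hBf, hha.eventually_analyticAt]
    with z hz hzr hzS hzq hzB hhz
  set s := S (‖z‖ ^ 2) with hs
  -- both sides are derivatives of the rotated loop at time `0`
  have hrot := hasDerivAt_circleExp_mul z
  have hlhs : HasDerivAt (fun α : ℝ => φ (Circle.exp α * z, S (‖(Circle.exp α : ℂ) * z‖ ^ 2)) 1)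
      (fderiv ℝ (fun z : ℂ => φ (z, S (‖z‖ ^ 2)) 1) z (Complex.I * z)) 0 := by
    have h1 : HasFDerivAt (fun z : ℂ => φ (z, S (‖z‖ ^ 2)) 1)
        (fderiv ℝ (fun z : ℂ => φ (z, S (‖z‖ ^ 2)) 1) z) ((Circle.exp 0 : ℂ) * z) := by
      rw [Circle.exp_zero, Circle.coe_one, one_mul]
      exact hhz.differentiableAt.hasFDerivAt
    exact h1.comp_hasDerivAt (0 : ℝ) hrot
  have hrepr : ∀ α : ℝ, φ (Circle.exp α * z, S (‖(Circle.exp α : ℂ) * z‖ ^ 2)) 1 =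
      Circle.exp α * (z + circlePrimitive ℂ (Λ (z, s)) (Circle.exp α)) := by
    intro α
    have h1 : ‖(Circle.exp α : ℂ) * z‖ = ‖z‖ := by simp
    rw [h1]
    have h2 := (hz.2.2 (Circle.exp α)).1
    rw [h2, circleRotate_apply, mul_one, hz.1]
    rfl
  have hone : HasDerivAt (fun α : ℝ => (Circle.exp α : ℂ)) Complex.I 0 := by
    simpa using hasDerivAt_circleExp_mul 1
  have hprim := hasDerivAt_circlePrimitive (Λ (z, s)) 0
  simp only [hrepr] at hlhs
  have heq := hlhs.unique (hone.mul (hprim.const_add z))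
  rw [heq]
  have hφ1 : φ (z, s) 1 = z + circlePrimitive ℂ (Λ (z, s)) 1 := by
    rw [hz.1]
    rfl
  have hΛ1 := hz.2.1 1
  -- the bifurcation function at `z`, by equivariance from its value at `‖z‖`
  have hmean : circleMean ℂ (Λ (z, s)) = (B (‖z‖, σ ‖z‖)).re * z := by
    have h1 := (hzr.2.2 (Circle.exp z.arg)).2
    have h2 : ((Circle.exp z.arg : Circle) : ℂ) * (‖z‖ : ℂ) = z := by
      rw [Circle.coe_exp, mul_comm, Complex.norm_mul_exp_arg_mul_I]
    rw [h2] at h1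
    rw [h1, circleMean_circleRotate]
    have h3 : circleMean ℂ (Λ ((‖z‖ : ℂ), s)) = (‖z‖ : ℂ) * B (‖z‖, σ ‖z‖) := by
      rw [← Complex.real_smul, ← hzS]
      exact hzB
    have h4 : B (‖z‖, σ ‖z‖) = ((B (‖z‖, σ ‖z‖)).re : ℂ) :=
      Complex.ext rfl (by simpa [hq] using hzq)
    rw [h3, ← mul_assoc, h2, h4, mul_comm, Complex.ofReal_re]
  rw [hmean, Circle.exp_zero, hΛ1, hφ1]
  simp only [Circle.coe_one, one_mul, inv_one, Complex.real_smul, Complex.ofReal_add,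
    Complex.ofReal_one]
  ring

/-! ### Vanishing of the defect, and conjugacy from related fields -/

theorem AnalyticAt.exists_local_inverse {E F : Type*} [NormedAddCommGroup E] [NormedSpace ℝ E]
    [CompleteSpace E] [NormedAddCommGroup F] [NormedSpace ℝ F] [CompleteSpace F] {f : E → F}
    (hf : AnalyticAt ℝ f 0) (hf0 : f 0 = 0) {L : E ≃L[ℝ] F}
    (hL : HasFDerivAt f (L : E →L[ℝ] F) 0) :
    ∃ e : OpenPartialHomeomorph E F, 0 ∈ e.source ∧ ⇑e = f ∧ AnalyticAt ℝ e.symm 0 := by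
  have hs : HasStrictFDerivAt f (L : E →L[ℝ] F) 0 := by
    rw [← hL.fderiv]
    exact hf.hasStrictFDerivAt
  have h0 : (0 : E) ∈ (hs.toOpenPartialHomeomorph f).source :=
    hs.mem_toOpenPartialHomeomorph_source
  refine ⟨hs.toOpenPartialHomeomorph f, h0, rfl, ?_⟩
  have := (hs.toOpenPartialHomeomorph f).analyticAt_symm' (i := L) h0 hf hL.fderiv
  rwa [show (hs.toOpenPartialHomeomorph f) 0 = 0 from hf0] at this

/-- The radial defect of the normal form vanishes at a center: the squared norm in the normal form
coordinates would otherwise be a strict Lyapunov function, for `Y` or for `-Y`. -/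
theorem radial_defect_eq_zero {Y h : ℂ → ℂ} {S β : ℝ → ℝ} (hper : NearbyPeriodic Y)
    (hh : AnalyticAt ℝ h 0) (hh0 : h 0 = 0)
    (hh' : HasFDerivAt h (ContinuousLinearMap.id ℝ ℂ) 0) (hS : AnalyticAt ℝ S 0) (hS0 : S 0 = 0)
    (hβ : AnalyticAt ℝ β 0) (hconj : ∀ᶠ z in 𝓝 (0 : ℂ),
      fderiv ℝ h z (Complex.I * z) = (1 + S (‖z‖ ^ 2)) • Y (h z) - β ‖z‖ • z) :
    ∀ᶠ z in 𝓝 (0 : ℂ), β ‖z‖ = 0 := by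
  have hnorm : Tendsto (fun z : ℂ => ‖z‖) (𝓝 0) (𝓝 0) := tendsto_norm_zero
  rcases hβ.eventually_eq_zero_or_eventually_ne_zero with h0 | hne
  · exact hnorm.eventually h0
  exfalso
  obtain ⟨ε, hε, hεβ⟩ := Metric.nhds_basis_ball.eventually_iff.1
    ((eventually_nhdsWithin_iff.1 hne).and hβ.eventually_analyticAt)
  have hsign : (∀ r ∈ Ioo 0 ε, 0 < β r) ∨ ∀ r ∈ Ioo 0 ε, β r < 0 := by
    have hmem : ∀ r ∈ Ioo 0 ε, r ∈ Metric.ball (0 : ℝ) ε := fun r hr => by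
      rw [mem_ball_zero_iff, Real.norm_eq_abs, abs_of_pos hr.1]
      exact hr.2
    have hcont : ContinuousOn β (Ioo 0 ε) := fun r hr =>
      (hεβ (hmem r hr)).2.continuousAt.continuousWithinAt
    by_contra! hcon
    obtain ⟨⟨a, ha, haβ⟩, b, hb, hbβ⟩ := hcon
    obtain ⟨r, hr, hr0⟩ := isPreconnected_Ioo.intermediate_value ha hb hcont ⟨haβ, hbβ⟩
    exact (hεβ (hmem r hr)).1 hr.1.ne' hr0
  obtain ⟨e, he0, heh, heg⟩ := hh.exists_local_inverse (L := ContinuousLinearEquiv.refl ℝ ℂ) hh0 hh'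
  have hg0 : e.symm 0 = 0 := by
    conv_lhs => rw [← hh0, ← heh]
    exact e.left_inv he0
  have hgt : Tendsto e.symm (𝓝 0) (𝓝 0) := by
    have := heg.continuousAt
    rwa [ContinuousAt, hg0] at this
  have hinv : ∀ᶠ ζ in 𝓝 (0 : ℂ), h (e.symm ζ) = ζ := by
    have : e.target ∈ 𝓝 (0 : ℂ) := e.open_target.mem_nhds (by
      have := e.map_source he0
      rwa [heh, hh0] at this)
    filter_upwards [this] with ζ hζ
    rw [← heh]
    exact e.right_inv hζ
  have hleft : ∀ᶠ z in 𝓝 (0 : ℂ), e.symm (h z) = z := by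
    filter_upwards [e.open_source.mem_nhds he0] with z hz
    rw [← heh]
    exact e.left_inv hz
  have hg' : fderiv ℝ e.symm 0 = ContinuousLinearMap.id ℝ ℂ := by
    have h1 : HasFDerivAt e.symm (fderiv ℝ e.symm 0) (h 0) := by
      rw [hh0]
      exact heg.differentiableAt.hasFDerivAt
    have h2 := (h1.comp 0 hh').unique ((hasFDerivAt_id (0 : ℂ)).congr_of_eventuallyEq hleft)
    simpa using h2
  have hclose : ∀ᶠ ζ in 𝓝 (0 : ℂ), ‖fderiv ℝ e.symm ζ - ContinuousLinearMap.id ℝ ℂ‖ < 1 / 2 := by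
    have h1 : ContinuousAt (fun ζ => ‖fderiv ℝ e.symm ζ - ContinuousLinearMap.id ℝ ℂ‖) 0 :=
      (heg.fderiv.continuousAt.sub continuousAt_const).norm
    exact h1.eventually (gt_mem_nhds (by simp only [hg', sub_self, norm_zero]; norm_num))
  have hSpos : ∀ᶠ z in 𝓝 (0 : ℂ), 0 < 1 + S (‖z‖ ^ 2) := by
    have h1 : ContinuousAt (fun z : ℂ => 1 + S (‖z‖ ^ 2)) 0 :=
      continuousAt_const.add (AnalyticAt.comp_of_eq hS (Complex.analyticAt_norm_sq 0)
        (by simp)).continuousAt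
    exact h1.eventually (lt_mem_nhds (by simp [hS0]))
  have hWd : ∀ᶠ ζ in 𝓝 (0 : ℂ), HasFDerivAt (fun ζ => ‖e.symm ζ‖ ^ 2)
      (2 • (innerSL ℝ (e.symm ζ)).comp (fderiv ℝ e.symm ζ)) ζ := by
    filter_upwards [heg.eventually_analyticAt] with ζ hζ
    exact hζ.differentiableAt.hasFDerivAt.norm_sq
  -- along `Y` the derivative of `‖h⁻¹ ζ‖ ^ 2` is a positive multiple of the defect
  have hmain : ∀ᶠ ζ in 𝓝 (0 : ℂ), ζ ≠ 0 → 0 < ‖e.symm ζ‖ ^ 2 ∧ ‖e.symm ζ‖ ∈ Ioo 0 ε ∧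
      ∃ m > 0, fderiv ℝ (fun ζ => ‖e.symm ζ‖ ^ 2) ζ (Y ζ) = m * β ‖e.symm ζ‖ := by
    filter_upwards [hinv, hWd, hclose, hgt.eventually hSpos, hgt.eventually hconj,
      hgt.eventually (Metric.ball_mem_nhds 0 hε), hgt.eventually hleft.eventually_nhds,
      heg.eventually_analyticAt, hgt.eventually hh.eventually_analyticAt]
      with ζ hζ hW hc hs hcj hbε hl hga hha hζ0
    set z := e.symm ζ with hz
    have hz0 : z ≠ 0 := by
      intro h
      rw [h, hh0] at hζ
      exact hζ0 hζ.symm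
    have hnz : 0 < ‖z‖ := norm_pos_iff.2 hz0
    refine ⟨by positivity, ⟨hnz, by simpa using hbε⟩,
      2 * inner ℝ z (fderiv ℝ e.symm ζ z) / (1 + S (‖z‖ ^ 2)), ?_, ?_⟩
    · have h1 : inner ℝ z (fderiv ℝ e.symm ζ z) =
          ‖z‖ ^ 2 + inner ℝ z ((fderiv ℝ e.symm ζ - ContinuousLinearMap.id ℝ ℂ) z) := by
        rw [sub_apply, ContinuousLinearMap.id_apply, inner_sub_right,
          real_inner_self_eq_norm_sq]
        ring
      have h2 := abs_real_inner_le_norm z ((fderiv ℝ e.symm ζ - ContinuousLinearMap.id ℝ ℂ) z)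
      have h3 : ‖(fderiv ℝ e.symm ζ - ContinuousLinearMap.id ℝ ℂ) z‖ ≤ 1 / 2 * ‖z‖ :=
        (ContinuousLinearMap.le_opNorm _ _).trans (by gcongr)
      have h4 : ‖z‖ * ‖(fderiv ℝ e.symm ζ - ContinuousLinearMap.id ℝ ℂ) z‖ ≤
          ‖z‖ * (1 / 2 * ‖z‖) := by gcongr
      have h5 : 0 < inner ℝ z (fderiv ℝ e.symm ζ z) := by
        rw [h1]
        nlinarith [(abs_le.1 h2).1]
      positivity
    · have h1 : HasFDerivAt e.symm (fderiv ℝ e.symm ζ) (h z) := by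
        rw [hζ]
        exact hga.differentiableAt.hasFDerivAt
      have h2 := (h1.comp z hha.differentiableAt.hasFDerivAt).unique
        ((hasFDerivAt_id z).congr_of_eventuallyEq hl)
      have h3 : fderiv ℝ e.symm ζ (fderiv ℝ h z (Complex.I * z)) = Complex.I * z :=
        DFunLike.congr_fun h2 (Complex.I * z)
      rw [hcj, hζ, map_sub, map_smul, map_smul] at h3
      have h4 : inner ℝ z (Complex.I * z) = 0 := by
        rw [Complex.inner]
        simp
        ring
      have h5 := congrArg (inner ℝ z) h3
      rw [h4, inner_sub_right, inner_smul_right, inner_smul_right] at h5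
      rw [hW.fderiv]
      have h6 : (2 • (innerSL ℝ z).comp (fderiv ℝ e.symm ζ)) (Y ζ) =
          2 * inner ℝ z (fderiv ℝ e.symm ζ (Y ζ)) := by
        simp
        ring
      rw [h6]
      field_simp
      linarith
  have hW0 : ‖e.symm 0‖ ^ 2 = 0 := by simp [hg0]
  have hWdiff : ∀ᶠ ζ in 𝓝 (0 : ℂ), DifferentiableAt ℝ (fun ζ => ‖e.symm ζ‖ ^ 2) ζ :=
    hWd.mono fun ζ hζ => hζ.differentiableAt
  rcases hsign with hpos | hneg
  · refine not_nearbyPeriodic_of_lyapunov hWdiff hW0 ?_ hper.neg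
    filter_upwards [hmain] with ζ hζ hζ0
    obtain ⟨h1, h2, m, hm, h3⟩ := hζ hζ0
    refine ⟨h1, ?_⟩
    rw [map_neg, h3, neg_lt_zero]
    exact mul_pos hm (hpos _ h2)
  · refine not_nearbyPeriodic_of_lyapunov hWdiff hW0 ?_ hper
    filter_upwards [hmain] with ζ hζ hζ0
    obtain ⟨h1, h2, m, hm, h3⟩ := hζ hζ0
    refine ⟨h1, ?_⟩
    rw [h3]
    exact mul_neg_of_pos_of_neg hm (hneg _ h2)

/-- An analytic local diffeomorphism `R` at the origin with `DR(p) (Y p) = X (R p)` yields, by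
restricting its local inverse, an analytic conjugacy from `X` to `Y`. -/
theorem locallyAnalyticallyConjugate_of_related {X Y R : ℝ × ℝ → ℝ × ℝ} {Ω₁ Ω₂ : Set (ℝ × ℝ)}
    (hΩ₁ : Ω₁ ∈ 𝓝 0) (hΩ₂ : Ω₂ ∈ 𝓝 0) (hR : AnalyticAt ℝ R 0) (hR0 : R 0 = 0)
    {L : (ℝ × ℝ) ≃L[ℝ] ℝ × ℝ} (hL : HasFDerivAt R (L : ℝ × ℝ →L[ℝ] ℝ × ℝ) 0)
    (hrel : ∀ᶠ p in 𝓝 0, fderiv ℝ R p (Y p) = X (R p)) :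
    LocallyAnalyticallyConjugate X Ω₁ (0, 0) Y Ω₂ (0, 0) := by
  obtain ⟨e, he0, heR, hes⟩ := hR.exists_local_inverse hR0 hL
  have hRt : Tendsto R (𝓝 0) (𝓝 0) := by
    have := hR.continuousAt
    rwa [ContinuousAt, hR0] at this
  obtain ⟨U, hUsub, hU, hU0⟩ := eventually_nhds_iff.1 ((eventually_mem_set.2 hΩ₂).and
    ((hRt.eventually (eventually_mem_set.2 hΩ₁)).and (hR.eventually_analyticAt.and
      ((hRt.eventually hes.eventually_analyticAt).and hrel))))
  have hsrc : ∀ q ∈ (e.restrOpen U hU).symm.source, e.symm q ∈ e.source ∧ e.symm q ∈ U ∧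
      R (e.symm q) = q := by
    intro q hq
    have h1 := (e.restrOpen U hU).symm.map_source hq
    have h2 : e.symm q ∈ e.source ∩ U := by simpa using h1
    refine ⟨h2.1, h2.2, ?_⟩
    rw [← heR]
    exact (e.restrOpen U hU).right_inv hq
  have h00 : e.symm 0 = 0 := by
    conv_lhs => rw [← hR0, ← heR]
    exact e.left_inv he0
  refine ⟨(e.restrOpen U hU).symm, ?_, ?_, ?_, ?_, ?_, ?_, ?_⟩
  · have h1 : (0 : ℝ × ℝ) ∈ (e.restrOpen U hU).source := by
      simpa using ⟨he0, hU0⟩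
    have h2 := (e.restrOpen U hU).map_source h1
    have h3 : (e.restrOpen U hU) 0 = 0 := by
      change e 0 = 0
      rw [heR, hR0]
    rw [h3] at h2
    exact h2
  · exact h00
  · intro q hq
    obtain ⟨-, h2, h3⟩ := hsrc q hq
    rw [← h3]
    exact (hUsub _ h2).2.1
  · intro p hp
    have hp' : p ∈ e.source ∩ U := by simpa using hp
    exact (hUsub p hp'.2).1
  · intro q hq
    obtain ⟨-, h2, h3⟩ := hsrc q hq
    have := (hUsub _ h2).2.2.2.1
    rw [h3] at this
    exact this
  · intro p hp
    have hp' : p ∈ e.source ∩ U := by simpa using hp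
    have := (hUsub p hp'.2).2.2.1
    rw [← heR] at this
    exact this
  · intro q hq
    obtain ⟨h1, h2, h3⟩ := hsrc q hq
    obtain ⟨-, -, hRa, hsa, hr⟩ := hUsub _ h2
    change fderiv ℝ e.symm q (X q) = Y (e.symm q)
    rw [h3] at hr
    rw [← hr]
    have hl : e.symm ∘ R =ᶠ[𝓝 (e.symm q)] id := by
      filter_upwards [e.open_source.mem_nhds h1] with p hp
      rw [Function.comp_apply, ← heR]
      exact e.left_inv hp
    have h4 := (hsa.differentiableAt.hasFDerivAt.comp _ hRa.differentiableAt.hasFDerivAt).unique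
      ((hasFDerivAt_id _).congr_of_eventuallyEq hl)
    have h5 := DFunLike.congr_fun h4 (Y (e.symm q))
    rw [h3] at h5
    exact h5

/-! ### The even potential -/

/-- An analytic function that is even on the whole line has an odd analytic primitive. -/
theorem AnalyticAt.exists_odd_primitive {k : ℝ → ℝ} (hk : AnalyticAt ℝ k 0)
    (heven : ∀ x, k (-x) = k x) :
    ∃ G : ℝ → ℝ, AnalyticAt ℝ G 0 ∧ (∀ x, G (-x) = -G x) ∧
      ∀ᶠ x in 𝓝 0, HasDerivAt G (k x) x := by
  obtain ⟨N, hN, hNk⟩ := hk.exists_superposition unitInterval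
  let A : C(unitInterval, ℝ →L[ℝ] ℝ) := ⟨fun t => (t : ℝ) • ContinuousLinearMap.id ℝ ℝ, by fun_prop⟩
  let I := ContinuousMap.weightedIntegralCLM ℝ 0 1 (.const ℝ 1)
    (⟨projIcc (0 : ℝ) 1 zero_le_one, continuous_projIcc⟩ : C(ℝ, unitInterval))
  have hAt : Tendsto A.flipCLM (𝓝 0) (𝓝 0) := A.flipCLM.continuous.tendsto' _ _ (map_zero _)
  have heq : ∀ᶠ x in 𝓝 (0 : ℝ), ∫ t in (0 : ℝ)..x, k t = x * I (N (A.flipCLM x)) := by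
    filter_upwards [hAt.eventually hNk] with x hx
    have h1 : I (N (A.flipCLM x)) = ∫ t in (0 : ℝ)..1, k (t * x) := by
      rw [ContinuousMap.weightedIntegralCLM_apply]
      refine intervalIntegral.integral_congr fun t ht => ?_
      rw [uIcc_of_le zero_le_one] at ht
      simp [hx, ContinuousMap.flipCLM_apply, A, projIcc_of_mem zero_le_one ht]
    rw [h1, intervalIntegral.mul_integral_comp_mul_right]
    simp
  refine ⟨fun x => ∫ t in (0 : ℝ)..x, k t, ?_, fun x => ?_, ?_⟩
  · refine AnalyticAt.congr (analyticAt_id.mul ?_) (heq.mono fun x hx => hx.symm)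
    refine (I.analyticAt _).comp (AnalyticAt.comp ?_ (A.flipCLM.analyticAt 0))
    simpa using hN
  · have := intervalIntegral.integral_comp_neg (a := 0) (b := x) k
    simp only [heven, neg_zero] at this
    change ∫ t in (0 : ℝ)..-x, k t = -∫ t in (0 : ℝ)..x, k t
    rw [this, intervalIntegral.integral_symm]
  · obtain ⟨ε, hε, hball⟩ := Metric.nhds_basis_ball.eventually_iff.1 hk.eventually_analyticAt
    filter_upwards [Metric.ball_mem_nhds 0 hε] with x hx
    have hcont : ContinuousOn k (Metric.ball 0 ε) := fun t ht =>
      (hball ht).continuousAt.continuousWithinAt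
    have hsub : uIcc 0 x ⊆ Metric.ball (0 : ℝ) ε :=
      (convex_ball (0 : ℝ) ε).ordConnected.uIcc_subset (Metric.mem_ball_self hε) hx
    exact intervalIntegral.integral_hasDerivAt_right (hcont.mono hsub).intervalIntegrable
      (hcont.stronglyMeasurableAtFilter Metric.isOpen_ball x hx) (hball hx).continuousAt

/-- The data of an even potential `V = g ^ 2 / 2`, where `g` is an odd analytic function with
`g' (x) * k (g x) = 1`. -/
theorem exists_potential {k : ℝ → ℝ} (hk : AnalyticAt ℝ k 0) (heven : ∀ x, k (-x) = k x)
    (hk0 : 0 < k 0) :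
    ∃ g : ℝ → ℝ, AnalyticAt ℝ g 0 ∧ g 0 = 0 ∧ (∀ᶠ x in 𝓝 0, g (-x) = -g x) ∧
      ∀ᶠ x in 𝓝 0, HasDerivAt g (k (g x))⁻¹ x ∧ 0 < k (g x) := by
  obtain ⟨G, hGa, hGodd, hGd⟩ := hk.exists_odd_primitive heven
  have hG0 : G 0 = 0 := by
    have := hGodd 0
    rw [neg_zero] at this
    linarith
  have hGF : HasFDerivAt G
      ((ContinuousLinearEquiv.unitsEquivAut ℝ (Units.mk0 (k 0) hk0.ne') : ℝ ≃L[ℝ] ℝ) :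
        ℝ →L[ℝ] ℝ) 0 := by
    refine hGd.self_of_nhds.hasFDerivAt.congr_fderiv ?_
    ext
    simp
  obtain ⟨e, he0, heG, hea⟩ := hGa.exists_local_inverse hG0 hGF
  have hg0 : e.symm 0 = 0 := by
    conv_lhs => rw [← hG0, ← heG]
    exact e.left_inv he0
  have hgt : Tendsto e.symm (𝓝 0) (𝓝 0) := by
    have := hea.continuousAt
    rwa [ContinuousAt, hg0] at this
  have htgt : e.target ∈ 𝓝 (0 : ℝ) := e.open_target.mem_nhds (by
    have := e.map_source he0
    rwa [heG, hG0] at this)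
  have hkpos : ∀ᶠ x in 𝓝 (0 : ℝ), 0 < k x := hk.continuousAt.eventually (lt_mem_nhds hk0)
  refine ⟨e.symm, hea, hg0, ?_, ?_⟩
  · have hnt : Tendsto (fun x => -e.symm x) (𝓝 0) (𝓝 0) := by simpa using hgt.neg
    filter_upwards [htgt, hnt.eventually (e.open_source.mem_nhds he0)] with x hx hx'
    have h1 : e (-e.symm x) = -x := by
      rw [heG, hGodd, ← heG, e.right_inv hx]
    rw [← h1, e.left_inv hx']
  · filter_upwards [htgt, hgt.eventually hGd, hgt.eventually hkpos] with x hx hd hpos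
    refine ⟨?_, hpos⟩
    rw [← heG] at hd
    exact e.hasDerivAt_symm hx hpos.ne' hd

/-- If `P` conjugates the field `I * ζ / k (Im ζ)` with `k` even to `X`, then `X` is conjugate to the
potential field of `V = g ^ 2 / 2`, where `g' (x) = 1 / k (g x)`: the substitution
`ζ = y + I * g x` turns `y ∂_x - V'(x) ∂_y` into `I * ζ / k (Im ζ)`. -/
theorem exists_potential_conjugacy {X : ℝ × ℝ → ℝ × ℝ} {Ω : Set (ℝ × ℝ)} (hΩ : Ω ∈ 𝓝 0)
    {k : ℝ → ℝ} (hk : AnalyticAt ℝ k 0) (heven : ∀ x, k (-x) = k x) (hk0 : 0 < k 0)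
    {P : ℂ → ℝ × ℝ} (hP : AnalyticAt ℝ P 0) (hP0 : P 0 = 0) {Φ : ℂ ≃L[ℝ] ℝ × ℝ}
    (hP' : HasFDerivAt P (Φ : ℂ →L[ℝ] ℝ × ℝ) 0)
    (hconj : ∀ᶠ ζ in 𝓝 (0 : ℂ), fderiv ℝ P ζ (Complex.I * ζ) = k ζ.im • X (P ζ)) :
    ∃ (V : ℝ → ℝ) (δ : ℝ), 0 < δ ∧
      AnalyticOnNhd ℝ V (Set.Ioo (-δ) δ) ∧
      V 0 = 0 ∧ deriv V 0 = 0 ∧ 0 < deriv (deriv V) 0 ∧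
      (∀ x ∈ Set.Ioo (-δ) δ, V (-x) = V x) ∧
      LocallyAnalyticallyConjugate X Ω (0, 0)
        (potentialField V) (Set.Ioo (-δ) δ ×ˢ Set.univ) (0, 0) := by
  obtain ⟨g, hga, hg0, hgodd, hgd⟩ := exists_potential hk heven hk0
  set V : ℝ → ℝ := fun x => g x ^ 2 / 2 with hV
  have hVa : AnalyticAt ℝ V 0 := (hga.pow 2).div_const
  have hVd : ∀ᶠ x in 𝓝 0, deriv V x = g x * (k (g x))⁻¹ := by
    filter_upwards [hgd] with x hx
    rw [((hx.1.fun_pow 2).div_const 2).deriv]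
    simp
    ring
  obtain ⟨δ, hδ, hball⟩ := Metric.nhds_basis_ball.eventually_iff.1
    (hVa.eventually_analyticAt.and hgodd)
  have hIoo : ∀ x ∈ Ioo (-δ) δ, x ∈ Metric.ball (0 : ℝ) δ := fun x hx => by
    rw [mem_ball_zero_iff, Real.norm_eq_abs]
    exact abs_lt.2 hx
  refine ⟨V, δ, hδ, fun x hx => (hball (hIoo x hx)).1, by simp [hV, hg0], ?_, ?_,
    fun x hx => by simp [hV, (hball (hIoo x hx)).2], ?_⟩
  · rw [hVd.self_of_nhds, hg0, zero_mul]
  · have h1 : HasDerivAt (fun x => g x * (k (g x))⁻¹) ((k 0)⁻¹ * (k 0)⁻¹) 0 := by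
      have h2 : DifferentiableAt ℝ (fun x => (k (g x))⁻¹) 0 := by
        have h3 : AnalyticAt ℝ (fun x => k (g x)) 0 := AnalyticAt.comp_of_eq hk hga hg0
        exact (h3.inv hgd.self_of_nhds.2.ne').differentiableAt
      refine (hgd.self_of_nhds.1.fun_mul h2.hasDerivAt).congr_deriv ?_
      rw [hg0, zero_mul, add_zero]
    rw [Filter.EventuallyEq.deriv_eq hVd, h1.deriv]
    positivity
  set Q : ℝ × ℝ → ℂ := fun p => (p.2 : ℂ) + g p.1 * Complex.I with hQ
  have hQa : AnalyticAt ℝ Q 0 := by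
    refine AnalyticAt.fun_add ?_ (AnalyticAt.fun_mul ?_ analyticAt_const)
    · exact (Complex.ofRealCLM.analyticAt _).comp analyticAt_snd
    · exact (Complex.ofRealCLM.analyticAt _).comp
        (AnalyticAt.comp_of_eq hga analyticAt_fst rfl)
  have hQ0 : Q 0 = 0 := by simp [hQ, hg0]
  have hQd : ∀ p : ℝ × ℝ, ∀ d : ℝ, HasDerivAt g d p.1 → HasFDerivAt Q
      (Complex.ofRealCLM ∘L ContinuousLinearMap.snd ℝ ℝ ℝ +
        (d * Complex.I : ℂ) • (Complex.ofRealCLM ∘L ContinuousLinearMap.fst ℝ ℝ ℝ)) p := by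
    intro p d hd
    have h1 : HasFDerivAt (fun p : ℝ × ℝ => (p.2 : ℂ))
        (Complex.ofRealCLM ∘L ContinuousLinearMap.snd ℝ ℝ ℝ) p :=
      (Complex.ofRealCLM ∘L ContinuousLinearMap.snd ℝ ℝ ℝ).hasFDerivAt
    have h2 := Complex.ofRealCLM.hasFDerivAt.comp p
      (hd.hasFDerivAt.comp p (hasFDerivAt_fst (𝕜 := ℝ) (p := p)))
    refine (h1.fun_add (h2.mul_const Complex.I)).congr_fderiv ?_
    ext <;> simp [mul_comm]
  have hQt : Tendsto Q (𝓝 0) (𝓝 0) := by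
    have := hQa.continuousAt
    rwa [ContinuousAt, hQ0] at this
  have hfst : Tendsto (fun p : ℝ × ℝ => p.1) (𝓝 0) (𝓝 0) := continuous_fst.tendsto' _ _ rfl
  let J : (ℝ × ℝ) ≃L[ℝ] ℂ := (planeEquiv 0 1 (k 0)⁻¹ 0 (by simp [hk0.ne'])).trans
    Complex.equivRealProdCLM.symm
  refine locallyAnalyticallyConjugate_of_related hΩ
    (prod_mem_nhds (Ioo_mem_nhds (neg_lt_zero.2 hδ) hδ) univ_mem)
    (R := fun p => P (Q p)) (AnalyticAt.comp_of_eq hP hQa hQ0) (by simp only [hQ0, hP0])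
    (L := J.trans Φ) ?_ ?_
  · have h1 := hQd 0 _ hgd.self_of_nhds.1
    have h2 : HasFDerivAt P (Φ : ℂ →L[ℝ] ℝ × ℝ) (Q 0) := by rwa [hQ0]
    refine (h2.comp 0 h1).congr_fderiv ?_
    refine ContinuousLinearMap.ext fun p => ?_
    change Φ _ = Φ (J p)
    congr 1
    apply Complex.ext <;> simp [J, hg0]
  · filter_upwards [hfst.eventually hgd, hQt.eventually hconj, hfst.eventually hVd,
      hQt.eventually hP.eventually_analyticAt] with p hgp hcp hVp hPp
    have h1 := hPp.differentiableAt.hasFDerivAt.comp p (hQd p _ hgp.1)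
    have hk' : k (g p.1) ≠ 0 := hgp.2.ne'
    have h2 : HasFDerivAt (fun p => P (Q p)) _ p := h1
    rw [h2.fderiv]
    have him : (Q p).im = g p.1 := by simp [hQ]
    have h3 : (Complex.ofRealCLM ∘L ContinuousLinearMap.snd ℝ ℝ ℝ +
        (((k (g p.1))⁻¹ : ℝ) * Complex.I : ℂ) •
          (Complex.ofRealCLM ∘L ContinuousLinearMap.fst ℝ ℝ ℝ)) (potentialField V p) =
        (k (g p.1))⁻¹ • (Complex.I * Q p) := by
      apply Complex.ext <;> simp [potentialField, hVp, hQ, mul_comm]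
    rw [ContinuousLinearMap.comp_apply, h3, map_smul, hcp, him, smul_smul, inv_mul_cancel₀ hk',
      one_smul]

theorem theorem1 (Ω : Set (ℝ × ℝ)) (hΩ : IsOpen Ω) (h0 : (0, 0) ∈ Ω)
    (X : ℝ × ℝ → ℝ × ℝ) (hX : AnalyticOnNhd ℝ X Ω)
    (hcenter : IsNondegenerateCenter X Ω (0, 0)) :
    ∃ (V : ℝ → ℝ) (δ : ℝ), 0 < δ ∧
      AnalyticOnNhd ℝ V (Set.Ioo (-δ) δ) ∧
      V 0 = 0 ∧ deriv V 0 = 0 ∧ 0 < deriv (deriv V) 0 ∧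
      (∀ x ∈ Set.Ioo (-δ) δ, V (-x) = V x) ∧
      LocallyAnalyticallyConjugate X Ω (0, 0)
        (potentialField V) (Set.Ioo (-δ) δ ×ˢ Set.univ) (0, 0) := by
  have hXa : AnalyticAt ℝ X 0 := hX (0, 0) h0
  have hX0 : X 0 = 0 := hcenter.1.1
  have hper := hcenter.1.nearbyPeriodic
  obtain ⟨Φ, ω, hω, hΦ⟩ :=
    hper.exists_linear_normal_form hXa.hasStrictFDerivAt hX0 hcenter.2
  have hωC : (ω : ℂ) ≠ 0 := by exact_mod_cast hω.ne'
  -- the field in coordinates in which its linear part is multiplication by `I`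
  set Y : ℂ → ℂ := fun ζ => ω⁻¹ • Φ.symm (X (Φ ζ)) with hY
  have hYper : NearbyPeriodic Y := (hper.conj Φ.symm).const_smul (inv_pos.2 hω)
  have hXΦ : AnalyticAt ℝ X (Φ 0) := by rwa [map_zero]
  have hYa : AnalyticAt ℝ Y 0 :=
    analyticAt_const.fun_smul ((Φ.symm.analyticAt _).comp (hXΦ.comp (Φ.analyticAt 0)))
  have hY0 : Y 0 = 0 := by simp [hY, hX0]
  have hY' : HasFDerivAt Y (ContinuousLinearMap.mul ℝ ℂ Complex.I) 0 := by
    have h1 := (Φ.symm.hasFDerivAt.comp (0 : ℂ)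
      (hXΦ.differentiableAt.hasFDerivAt.comp (0 : ℂ) Φ.hasFDerivAt)).const_smul ω⁻¹
    refine h1.congr_fderiv (ContinuousLinearMap.ext fun ζ => ?_)
    have h2 : fderiv ℝ X (Φ 0) (Φ ζ) = Φ (ω * Complex.I * ζ) := by
      rw [map_zero]
      exact hΦ ζ
    simp only [smul_apply, ContinuousLinearMap.comp_apply, ContinuousLinearEquiv.coe_coe, h2,
      ContinuousLinearEquiv.symm_apply_apply, ContinuousLinearMap.mul_apply', Complex.real_smul,
      Complex.ofReal_inv]
    field_simp
  obtain ⟨h, S, β, hh, hh0, hh', hS, hS0, hβ, hconj⟩ := exists_rotation_normal_form hYa hY0 hY'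
  have hdefect := radial_defect_eq_zero hYper hh hh0 hh' hS hS0 hβ hconj
  set s : ℝ → ℝ := fun τ => (1 + S τ) * ω⁻¹ with hs
  have hsa : AnalyticAt ℝ s 0 := (analyticAt_const.add hS).mul analyticAt_const
  have hs0 : 0 < s 0 := by simp [hs, hS0, hω]
  obtain ⟨k, hk, heven, hk0, havg⟩ := hsa.exists_even_circleAverage
  obtain ⟨Ψ, hΨ, hΨ0, hΨ', hΨconj⟩ := exists_angle_straightening hk hsa hs0 havg
  have hΨt : Tendsto Ψ (𝓝 0) (𝓝 0) := by
    have := hΨ.continuousAt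
    rwa [ContinuousAt, hΨ0] at this
  have hspos : ∀ᶠ ζ : ℂ in 𝓝 0, s (‖ζ‖ ^ 2) ≠ 0 := by
    have h1 : ContinuousAt (fun ζ : ℂ => s (‖ζ‖ ^ 2)) 0 :=
      (AnalyticAt.comp_of_eq hsa (Complex.analyticAt_norm_sq 0) (by simp)).continuousAt
    exact h1.eventually_ne (by simpa using hs0.ne')
  refine exists_potential_conjugacy (hΩ.mem_nhds h0) hk heven (by rwa [hk0])
    (P := fun ζ => Φ (h (Ψ ζ))) ((Φ.analyticAt _).comp (AnalyticAt.comp_of_eq hh hΨ hΨ0))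
    (by simp [hΨ0, hh0]) (Φ := Φ) ?_ ?_
  · have h1 : HasFDerivAt h (ContinuousLinearMap.id ℝ ℂ) (Ψ 0) := by rwa [hΨ0]
    have h2 := Φ.hasFDerivAt.comp (0 : ℂ) (h1.comp (0 : ℂ) hΨ')
    simpa [Function.comp_def] using h2
  · filter_upwards [hΨconj, hspos, hΨt.eventually hconj, hΨt.eventually hdefect,
      hΨ.eventually_analyticAt, hΨt.eventually hh.eventually_analyticAt]
      with ζ hζ hsζ hcζ hdζ hΨa hha
    have h1 : HasFDerivAt (fun ζ => Φ (h (Ψ ζ))) _ ζ := Φ.hasFDerivAt.comp ζ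
      (hha.differentiableAt.hasFDerivAt.comp ζ hΨa.differentiableAt.hasFDerivAt)
    rw [hdζ, zero_smul, sub_zero, hζ.1] at hcζ
    have h2 : fderiv ℝ Ψ ζ (Complex.I * ζ) = (s (‖ζ‖ ^ 2))⁻¹ • k ζ.im • (Complex.I * Ψ ζ) := by
      rw [← hζ.2, smul_smul, inv_mul_cancel₀ hsζ, one_smul]
    have h3 : (1 + S (‖ζ‖ ^ 2)) • Y (h (Ψ ζ)) = s (‖ζ‖ ^ 2) • Φ.symm (X (Φ (h (Ψ ζ)))) := by
      simp only [hY, hs, smul_smul]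
    rw [h1.fderiv, ContinuousLinearMap.comp_apply, ContinuousLinearMap.comp_apply, h2]
    rw [(fderiv ℝ h (Ψ ζ)).map_smul, (fderiv ℝ h (Ψ ζ)).map_smul, hcζ, h3,
      smul_comm (k ζ.im), smul_smul, inv_mul_cancel₀ hsζ, one_smul]
    exact (map_smul Φ _ _).trans (by rw [Φ.apply_symm_apply])
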